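/- Let $p\le n$ and let $St(n,p)=\{U\in\mathbb{R}^{n\times p}\mid U^TU=I_p\}$ be the Stiefel manifold, an embedded submanifold of $\mathbb{R}^{n\times p}$ with tangent spaces $T_USt(n,p)=\{\Delta\in\mathbb{R}^{n\times p}\mid U^T\Delta=-\Delta^TU\}$, equipped with the canonical Riemannian metric $\langle\Delta_1,\Delta_2\rangle_U=\operatorname{tr}\bigl(\Delta_1^T(I-\tfrac12UU^T)\Delta_2\bigr)$. Let $d$ be the Riemannian distance, that is, the infimum of the lengths of the piecewise smooth curves in $St(n,p)$ joining two points ($\inf\emptyset=\infty$), and let $\mathrm{Exp}_U:T_USt(n,p)\to St(n,p)$ be the Riemannian exponential. For a geodesic $\gamma$ with unit speed and $\gamma(0)=U$, the set of all $t>0$ with $d(\gamma(0),\gamma(t))=t$ is either $(0,t_0]$ for some $t_0>0$ or $(0,\infty)$; in the first case $\gamma(t_0)$ is called the cut point of $U$ along $\gamma$. The cut locus $\mathrm{Cut}(U)$ is the set of the cut points of $U$ along all unit speed geodesics starting at $U$, and $d(U,\mathrm{Cut}(U))=\inf_{V\in\mathrm{Cut}(U)}d(U,V)$ (again $\inf\emptyset=\infty$).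 The injectivity radius $i_U(St(n,p))\in[0,\infty]$ at $U$ is the largest $r$ such that $\mathrm{Exp}_U$ is invertible, as a map onto its image, on the open ball $B_r(0)\subset T_USt(n,p)$, and $i(St(n,p))=\inf_{U\in St(n,p)}i_U(St(n,p))$. Then $d(U,\mathrm{Cut}(U))=d(V,\mathrm{Cut}(V))$ for all $U,V\in St(n,p)$, and for every $U\in St(n,p)$ \[ i(St(n,p))=d(U,\mathrm{Cut}(U)). \] -/

import Mathlib

open scoped ContDiff ENNReal

noncomputable section

namespace StiefelManifold

variable {n p : ℕ}

/-- The compact Stiefel manifold `St(n,p) = {U ∈ ℝ^{n×p} | Uᵀ U = I_p}`, as a subset (embedded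
submanifold) of the space of real `n × p` matrices. -/
def St (n p : ℕ) : Set (Matrix (Fin n) (Fin p) ℝ) :=
  {U | U.transpose * U = 1}

/-- The tangent space `T_U St(n,p) = {Δ ∈ ℝ^{n×p} | Uᵀ Δ = - Δᵀ U}`. -/
def tangent (U : Matrix (Fin n) (Fin p) ℝ) : Set (Matrix (Fin n) (Fin p) ℝ) :=
  {X | U.transpose * X = -(X.transpose * U)}

/-- The canonical metric `⟨X, Y⟩_U = tr (Xᵀ (I - ½ U Uᵀ) Y)`. The formula is used for all matrices
`U, X, Y`; for `U ∈ St(n,p)` and `X, Y ∈ T_U St(n,p)` it is the canonical metric, see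
`canonicalMetric_eq`. -/
def canonicalMetric (U X Y : Matrix (Fin n) (Fin p) ℝ) : ℝ :=
  (X.transpose * (1 - (1 / 2 : ℝ) • (U * U.transpose)) * Y).trace

/-- In terms of `Δ₁ = U A₁ + U^⊥ B₁` and `Δ₂ = U A₂ + U^⊥ B₂`, where the columns of `(U, U^⊥)` are
orthonormal, the canonical metric reads `⟨Δ₁, Δ₂⟩_U = ½ tr (A₁ᵀ A₂) + tr (B₁ᵀ B₂)`. -/
theorem canonicalMetric_eq {m : ℕ} (U : Matrix (Fin n) (Fin p) ℝ) (V : Matrix (Fin n) (Fin m) ℝ)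
    (hU : U.transpose * U = 1) (hUV : U.transpose * V = 0) (hV : V.transpose * V = 1)
    (A₁ A₂ : Matrix (Fin p) (Fin p) ℝ) (B₁ B₂ : Matrix (Fin m) (Fin p) ℝ) :
    canonicalMetric U (U * A₁ + V * B₁) (U * A₂ + V * B₂) =
      1 / 2 * (A₁.transpose * A₂).trace + (B₁.transpose * B₂).trace := by
  have hVU : V.transpose * U = 0 := by
    have h := congrArg Matrix.transpose hUV
    simpa [Matrix.transpose_mul] using h
  have h2 : (1 - (1 / 2 : ℝ) • (U * U.transpose)) * (U * A₂ + V * B₂)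
      = (1 / 2 : ℝ) • (U * A₂) + V * B₂ := by
    have e1 : U * U.transpose * (U * A₂) = U * A₂ := by
      rw [Matrix.mul_assoc, ← Matrix.mul_assoc U.transpose, hU, Matrix.one_mul]
    have e2 : U * U.transpose * (V * B₂) = 0 := by
      rw [Matrix.mul_assoc, ← Matrix.mul_assoc U.transpose, hUV, Matrix.zero_mul, Matrix.mul_zero]
    rw [Matrix.sub_mul, Matrix.one_mul, Matrix.smul_mul, Matrix.mul_add, e1, e2, add_zero]
    module
  have f1 : (U * A₁).transpose * (U * A₂) = A₁.transpose * A₂ := by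
    rw [Matrix.transpose_mul, Matrix.mul_assoc, ← Matrix.mul_assoc U.transpose, hU, Matrix.one_mul]
  have f2 : (U * A₁).transpose * (V * B₂) = 0 := by
    rw [Matrix.transpose_mul, Matrix.mul_assoc, ← Matrix.mul_assoc U.transpose, hUV,
      Matrix.zero_mul, Matrix.mul_zero]
  have f3 : (V * B₁).transpose * (U * A₂) = 0 := by
    rw [Matrix.transpose_mul, Matrix.mul_assoc, ← Matrix.mul_assoc V.transpose, hVU,
      Matrix.zero_mul, Matrix.mul_zero]
  have f4 : (V * B₁).transpose * (V * B₂) = B₁.transpose * B₂ := by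
    rw [Matrix.transpose_mul, Matrix.mul_assoc, ← Matrix.mul_assoc V.transpose, hV, Matrix.one_mul]
  unfold canonicalMetric
  rw [Matrix.mul_assoc, h2, Matrix.transpose_add, Matrix.add_mul, Matrix.mul_add, Matrix.mul_add,
    Matrix.mul_smul, Matrix.mul_smul, f1, f2, f3, f4]
  simp

/-- The length `‖X‖_U = √⟨X, X⟩_U` of a tangent vector. -/
def tangentNorm (U X : Matrix (Fin n) (Fin p) ℝ) : ℝ :=
  Real.sqrt (canonicalMetric U X X)

/-- Smoothness on `s` of a matrix-valued function of one real variable (entry by entry). -/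
def SmoothOn (c : ℝ → Matrix (Fin n) (Fin p) ℝ) (s : Set ℝ) : Prop :=
  ∀ i j, ContDiffOn ℝ ∞ (fun t => c t i j) s

/-- The derivative of a matrix-valued function of one real variable (entry by entry). -/
def velocity (c : ℝ → Matrix (Fin n) (Fin p) ℝ) (t : ℝ) : Matrix (Fin n) (Fin p) ℝ :=
  Matrix.of fun i j => deriv (fun s => c s i j) t

/-- `c : [a, b] → ℝ^{n×p}` is piecewise smooth: there is a subdivision
`a = τ 0 < τ 1 < ⋯ < τ k = b` such that `c` is smooth on every closed interval
`[τ i, τ (i + 1)]` (with one-sided derivatives at the ends). -/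
def PiecewiseSmooth (c : ℝ → Matrix (Fin n) (Fin p) ℝ) (a b : ℝ) : Prop :=
  ∃ (k : ℕ) (τ : ℕ → ℝ), τ 0 = a ∧ τ k = b ∧
    ∀ i < k, τ i < τ (i + 1) ∧ SmoothOn c (Set.Icc (τ i) (τ (i + 1)))

/-- The length `L(c) = ∫_a^b ‖c'(t)‖_{c(t)} dt`. -/
def curveLength (c : ℝ → Matrix (Fin n) (Fin p) ℝ) (a b : ℝ) : ℝ≥0∞ :=
  ∫⁻ t in Set.Icc a b, ENNReal.ofReal (tangentNorm (c t) (velocity c t))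

/-- The Riemannian distance on `St(n,p)`: the infimum of the lengths of the piecewise smooth curves
in `St(n,p)` from `U` to `V` (`∞` if there is no such curve). -/
def riemDist (U V : Matrix (Fin n) (Fin p) ℝ) : ℝ≥0∞ :=
  sInf {L | ∃ (c : ℝ → Matrix (Fin n) (Fin p) ℝ) (a b : ℝ),
    PiecewiseSmooth c a b ∧ (∀ t ∈ Set.Icc a b, c t ∈ St n p) ∧ c a = U ∧ c b = V ∧
      L = curveLength c a b}

/-- The Christoffel symbols of the first kind of the canonical metric in the ambient coordinates:
`Γ_U(X, Y; W) = ½ (∂_X ⟨Y, W⟩ + ∂_Y ⟨X, W⟩ - ∂_W ⟨X, Y⟩)`, where `∂_Z ⟨X, Y⟩` is the directional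
derivative at `U` of `V ↦ ⟨X, Y⟩_V` for fixed matrices `X, Y`. -/
def christoffel (U X Y W : Matrix (Fin n) (Fin p) ℝ) : ℝ :=
  (lineDeriv ℝ (fun V => canonicalMetric V Y W) U X
    + lineDeriv ℝ (fun V => canonicalMetric V X W) U Y
    - lineDeriv ℝ (fun V => canonicalMetric V X Y) U W) / 2

/-- `Z` is the (Levi-Civita) covariant derivative at time `t` of the vector field `X` along the
curve `c` in `St(n,p)`: it is the tangent vector `Z` at `c t` with
`⟨Z, W⟩ = ⟨X'(t), W⟩ + Γ_{c(t)}(c'(t), X(t); W)` for all tangent vectors `W` at `c t`. That is, `Z`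
is the orthogonal projection onto the tangent space of the covariant derivative of `X` in an ambient
neighbourhood of `St(n,p)`, to which the canonical metric is extended by its formula; this is the
Levi-Civita connection of the induced metric, whatever the extension. -/
def IsCovDerivAt (c X : ℝ → Matrix (Fin n) (Fin p) ℝ) (t : ℝ)
    (Z : Matrix (Fin n) (Fin p) ℝ) : Prop :=
  Z ∈ tangent (c t) ∧ ∀ W ∈ tangent (c t),
    canonicalMetric (c t) Z W =
      canonicalMetric (c t) (velocity X t) W + christoffel (c t) (velocity c t) (X t) W

/-- Geodesics of `St(n,p)` with the canonical metric: smooth curves in `St(n,p)` whose velocity field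
has vanishing covariant derivative. (`St(n,p)` is complete, so every geodesic extends to `ℝ`.) -/
structure IsGeodesic (γ : ℝ → Matrix (Fin n) (Fin p) ℝ) : Prop where
  smooth : SmoothOn γ Set.univ
  mem : ∀ t, γ t ∈ St n p
  covDeriv_eq_zero : ∀ t, IsCovDerivAt γ (velocity γ) t 0

/-- The Riemannian exponential `Exp_U(Δ) = γ(1)`, where `γ` is the geodesic with `γ(0) = U` and
`γ'(0) = Δ`, for `U ∈ St(n,p)` and `Δ ∈ T_U St(n,p)`. -/
def riemExp (U X : Matrix (Fin n) (Fin p) ℝ) : Matrix (Fin n) (Fin p) ℝ :=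
  Classical.epsilon fun V => ∃ γ : ℝ → Matrix (Fin n) (Fin p) ℝ,
    IsGeodesic γ ∧ γ 0 = U ∧ velocity γ 0 = X ∧ γ 1 = V

/-- The open ball `B_r(0)` in `T_U St(n,p)`; `r = ∞` gives the whole tangent space. -/
def tangentBall (U : Matrix (Fin n) (Fin p) ℝ) (r : ℝ≥0∞) : Set (Matrix (Fin n) (Fin p) ℝ) :=
  {X | X ∈ tangent U ∧ ENNReal.ofReal (tangentNorm U X) < r}

/-- The injectivity radius at `U`: the largest `r ∈ [0, ∞]` such that `Exp_U`, as a map from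
`B_r(0) ⊆ T_U St(n,p)` onto its image, is invertible. -/
def injRadiusAt (U : Matrix (Fin n) (Fin p) ℝ) : ℝ≥0∞ :=
  sSup {r | Set.InjOn (riemExp U) (tangentBall U r)}

/-- The injectivity radius of `St(n,p)`. -/
def injRadius (n p : ℕ) : ℝ≥0∞ :=
  ⨅ U ∈ St n p, injRadiusAt U

/-- `V` is the cut point of `U` along the normalized geodesic `γ` starting at `U`: `V = γ(t₀)`, where
the set of the `t > 0` with `d(γ(0), γ(t)) = t` is the bounded interval `(0, t₀]`. -/
def IsCutPointAlong (U : Matrix (Fin n) (Fin p) ℝ) (γ : ℝ → Matrix (Fin n) (Fin p) ℝ)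
    (V : Matrix (Fin n) (Fin p) ℝ) : Prop :=
  IsGeodesic γ ∧ (∀ t, tangentNorm (γ t) (velocity γ t) = 1) ∧ γ 0 = U ∧
    ∃ t₀ : ℝ, 0 < t₀ ∧
      {t : ℝ | 0 < t ∧ riemDist (γ 0) (γ t) = ENNReal.ofReal t} = Set.Ioc 0 t₀ ∧ V = γ t₀

/-- The cut locus `Cut(U)`. -/
def cutLocus (U : Matrix (Fin n) (Fin p) ℝ) : Set (Matrix (Fin n) (Fin p) ℝ) :=
  {V | ∃ γ : ℝ → Matrix (Fin n) (Fin p) ℝ, IsCutPointAlong U γ V}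

/-- `d(U, S) = inf_{V ∈ S} d(U, V)`, with `d(U, ∅) = ∞`. -/
def distToSet (U : Matrix (Fin n) (Fin p) ℝ) (S : Set (Matrix (Fin n) (Fin p) ℝ)) : ℝ≥0∞ :=
  ⨅ V ∈ S, riemDist U V

end StiefelManifold

end

open scoped ContDiff ENNReal Topology Matrix.Norms.Frobenius
open Matrix NormedSpace Filter MeasureTheory

namespace StiefelManifold

variable {n p m : ℕ}

/-! The manifold is a quotient of the orthogonal group, and the canonical metric is half the
quotient of the Frobenius metric. A skew matrix `A` splits orthogonally into `hor U (A * U)` and a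
part killing `U`, a tangent vector `X` has length `‖hor U X‖ / √2`, and the geodesics are the orbits
`exp (t • hor U X) * U`. Hence the distance from `U` to a point `V` in its component is the minimum
of `‖A‖ / √2` over skew `A` with `exp A * U = V`, and a minimiser is automatically horizontal
(`Reach.exists_horizontal`). The lower bound rests on a triangle inequality for norms of logarithms,
`exists_exp_eq_mul`, obtained by a discrete calculus of variations in the orthogonal group.

Write ρ for the distance from `U` to its cut locus; then the injectivity radius at `U` equals ρ.
Geodesics of length less than ρ minimise. If distinct `X`, `Y` of length less than ρ had the same
image, they would have the same length. A slight prolongation of the geodesic of `X` still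
minimises, yet following `Y` and then the prolongation turns a corner, which can be shortened
strictly (`exists_exp_eq_mul_of_ne`). No conjugate points enter. Conversely, let the exponential be
injective on the ball of radius r, and suppose a cut point occurs at time t₀ < r along γ. For t₀ < t
< r, a minimal geodesic to γ(t) has initial vector in the ball, so it is γ itself, which contradicts
t > t₀.

Finally, left multiplication by orthogonal matrices preserves norms and exponentials and is
transitive for p ≤ n. So the injectivity radius is the same at all points, and with it ρ. -/

theorem mem_St {U : Matrix (Fin n) (Fin p) ℝ} : U ∈ St n p ↔ Uᵀ * U = 1 := Iff.rfl

/-! ### Frobenius norm and orthogonal matrices -/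

theorem norm_sq_eq_trace (A : Matrix (Fin n) (Fin p) ℝ) : ‖A‖ ^ 2 = (Aᵀ * A).trace := by
  rw [frobenius_norm_def, ← Real.sqrt_eq_rpow, Real.sq_sqrt (by positivity), Finset.sum_comm]
  simp [Matrix.trace, Matrix.mul_apply, pow_two]

theorem trace_transpose_mul_comm (A B : Matrix (Fin n) (Fin p) ℝ) :
    (Aᵀ * B).trace = (Bᵀ * A).trace := by
  rw [← trace_transpose, transpose_mul, transpose_transpose]

theorem norm_add_sq_eq (A B : Matrix (Fin n) (Fin p) ℝ) :
    ‖A + B‖ ^ 2 = ‖A‖ ^ 2 + ‖B‖ ^ 2 + 2 * (Aᵀ * B).trace := by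
  simp only [norm_sq_eq_trace, transpose_add, Matrix.add_mul, Matrix.mul_add, trace_add]
  rw [trace_transpose_mul_comm B A]
  ring

theorem norm_sub_sq_eq (A B : Matrix (Fin n) (Fin p) ℝ) :
    ‖A - B‖ ^ 2 = ‖A‖ ^ 2 + ‖B‖ ^ 2 - 2 * (Aᵀ * B).trace := by
  have := norm_add_sq_eq A (-B)
  rw [norm_neg, Matrix.mul_neg, trace_neg, ← sub_eq_add_neg] at this
  rw [this]; ring

/-- Strict Cauchy–Schwarz, read off from the positive square `‖‖B‖ • A - ‖A‖ • B‖ ^ 2`. -/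
theorem norm_add_lt_of_ne {A B : Matrix (Fin n) (Fin p) ℝ} (h : ‖B‖ • A ≠ ‖A‖ • B) :
    ‖A + B‖ < ‖A‖ + ‖B‖ := by
  have h1 : 0 < ‖‖B‖ • A - ‖A‖ • B‖ ^ 2 := by
    have := norm_pos_iff.2 (sub_ne_zero.2 h)
    positivity
  rw [norm_sub_sq_eq] at h1
  simp only [norm_smul, transpose_smul, Matrix.smul_mul, Matrix.mul_smul, trace_smul, smul_eq_mul,
    norm_norm] at h1
  have hA : 0 < ‖A‖ := norm_pos_iff.2 (by rintro rfl; simp at h)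
  have hB : 0 < ‖B‖ := norm_pos_iff.2 (by rintro rfl; simp at h)
  have h2 : (Aᵀ * B).trace < ‖A‖ * ‖B‖ := by
    have hAB : 0 < ‖A‖ * ‖B‖ := by positivity
    by_contra hc
    push Not at hc
    nlinarith [mul_le_mul_of_nonneg_left hc hAB.le]
  refine lt_of_pow_lt_pow_left₀ 2 (by positivity) ?_
  rw [norm_add_sq_eq]
  nlinarith

theorem norm_mul_left_of_mem_St {U : Matrix (Fin n) (Fin m) ℝ} (hU : U ∈ St n m)
    (M : Matrix (Fin m) (Fin p) ℝ) : ‖U * M‖ = ‖M‖ := by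
  have : ‖U * M‖ ^ 2 = ‖M‖ ^ 2 := by
    rw [norm_sq_eq_trace, norm_sq_eq_trace, transpose_mul, Matrix.mul_assoc, ← Matrix.mul_assoc Uᵀ,
      mem_St.1 hU, Matrix.one_mul]
  exact (pow_left_inj₀ (norm_nonneg _) (norm_nonneg _) two_ne_zero).1 this

theorem mul_transpose_of_mem_St {Q : Matrix (Fin n) (Fin n) ℝ} (hQ : Q ∈ St n n) :
    Q * Qᵀ = 1 := mul_eq_one_comm.1 hQ

theorem transpose_mem_St {Q : Matrix (Fin n) (Fin n) ℝ} (hQ : Q ∈ St n n) : Qᵀ ∈ St n n := by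
  rw [mem_St, transpose_transpose, mul_transpose_of_mem_St hQ]

theorem one_mem_St : (1 : Matrix (Fin n) (Fin n) ℝ) ∈ St n n := by simp [mem_St]

theorem mul_mem_St {Q : Matrix (Fin n) (Fin m) ℝ} (hQ : Q ∈ St n m)
    {U : Matrix (Fin m) (Fin p) ℝ} (hU : U ∈ St m p) : Q * U ∈ St n p := by
  rw [mem_St, transpose_mul, Matrix.mul_assoc, ← Matrix.mul_assoc Qᵀ, mem_St.1 hQ, Matrix.one_mul,
    mem_St.1 hU]

theorem norm_mul_right_of_mem_St {Q : Matrix (Fin n) (Fin n) ℝ} (hQ : Q ∈ St n n)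
    (M : Matrix (Fin m) (Fin n) ℝ) : ‖M * Q‖ = ‖M‖ := by
  rw [← frobenius_norm_transpose, transpose_mul, norm_mul_left_of_mem_St (transpose_mem_St hQ),
    frobenius_norm_transpose]

theorem exp_skew_mem_St {A : Matrix (Fin n) (Fin n) ℝ} (hA : Aᵀ = -A) : exp A ∈ St n n := by
  rw [mem_St, ← exp_transpose, hA, ← exp_add_of_commute _ _ (Commute.neg_left (Commute.refl A))]
  simp

theorem skew_smul {A : Matrix (Fin n) (Fin n) ℝ} (hA : Aᵀ = -A) (s : ℝ) :
    (s • A)ᵀ = -(s • A) := by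
  rw [transpose_smul, hA, smul_neg]

theorem exp_add_smul (A : Matrix (Fin n) (Fin n) ℝ) (s t : ℝ) :
    exp ((s + t) • A) = exp (s • A) * exp (t • A) := by
  rw [add_smul, exp_add_of_commute _ _ (((Commute.refl A).smul_left s).smul_right t)]

theorem isClosed_St : IsClosed (St n p) :=
  isClosed_eq (by fun_prop) continuous_const

theorem norm_of_mem_St {U : Matrix (Fin n) (Fin p) ℝ} (hU : U ∈ St n p) : ‖U‖ = √p := by
  rw [← Real.sqrt_sq (norm_nonneg U), norm_sq_eq_trace, mem_St.1 hU]
  simp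

theorem isCompact_St : IsCompact (St n p) := by
  refine Metric.isCompact_of_isClosed_isBounded isClosed_St ?_
  refine (Metric.isBounded_closedBall (x := 0) (r := √p)).subset fun U hU => ?_
  rw [mem_closedBall_zero_iff, norm_of_mem_St hU]

theorem hasDerivAt_exp_smul (A : Matrix (Fin n) (Fin n) ℝ) (t : ℝ) :
    HasDerivAt (fun u : ℝ => exp (u • A)) (exp (t • A) * A) t :=
  hasDerivAt_exp_smul_const A t

theorem hasDerivAt_exp_smul' (A : Matrix (Fin n) (Fin n) ℝ) (t : ℝ) :
    HasDerivAt (fun u : ℝ => exp (u • A)) (A * exp (t • A)) t :=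
  hasDerivAt_exp_smul_const' A t

theorem norm_exp_smul_sub_le {A : Matrix (Fin n) (Fin n) ℝ} (hA : Aᵀ = -A) (s t : ℝ) :
    ‖exp (t • A) - exp (s • A)‖ ≤ ‖A‖ * |t - s| := by
  refine Convex.norm_image_sub_le_of_norm_hasDerivWithin_le (s := Set.univ)
    (fun x _ => (hasDerivAt_exp_smul A x).hasDerivWithinAt) (fun x _ => ?_) convex_univ
    (Set.mem_univ s) (Set.mem_univ t)
  rw [norm_mul_left_of_mem_St (exp_skew_mem_St (skew_smul hA x))]

theorem continuous_exp_matrix : Continuous (fun A : Matrix (Fin n) (Fin n) ℝ => exp A) :=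
  exp_continuous

/-! ### Shortening curves in the orthogonal group to one-parameter subgroups -/

/-- Orthogonal matrices at distance less than one from the identity are determined by their
skew-symmetric part. -/
theorem eq_of_skewPart_eq {R R' : Matrix (Fin n) (Fin n) ℝ} (hR : R ∈ St n n) (hR' : R' ∈ St n n)
    (h : ‖R - 1‖ < 1) (h' : ‖R' - 1‖ < 1) (hK : R - Rᵀ = R' - R'ᵀ) : R = R' := by
  set S := R + Rᵀ with hS
  set S' := R' + R'ᵀ with hS'
  -- The skew part of an orthogonal matrix determines the square of its symmetric part; closeness to
  -- the identity then selects the square root.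
  have hsq : ∀ Q ∈ St n n, (Q + Qᵀ) * (Q + Qᵀ) = (Q - Qᵀ) * (Q - Qᵀ) + 4 • 1 := by
    intro Q hQ
    have h1 := mem_St.1 hQ
    have h2 := mul_transpose_of_mem_St hQ
    simp only [Matrix.add_mul, Matrix.mul_add, Matrix.sub_mul, Matrix.mul_sub, h1, h2]
    module
  have h0 : S * S = S' * S' := by rw [hS, hS', hsq R hR, hsq R' hR', hK]
  have hnorm : ∀ Q : Matrix (Fin n) (Fin n) ℝ, ‖Q - 1‖ < 1 → ‖Q + Qᵀ - 2 • 1‖ < 2 := by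
    intro Q hQ
    have : Q + Qᵀ - 2 • 1 = (Q - 1) + (Q - 1)ᵀ := by
      rw [transpose_sub, transpose_one]; module
    rw [this]
    refine (norm_add_le _ _).trans_lt ?_
    rw [frobenius_norm_transpose]; linarith
  set T := S - S' with hT
  -- `S * T + T * S' = S² - S'² = 0`. Since `S` and `S'` are within distance 2 of `2 • 1`, the
  -- right-hand side is strictly smaller than `4‖T‖` unless `T = 0`.
  have e : (4 : ℝ) • T = -((S - 2 • 1) * T + T * (S' - 2 • 1)) := by
    have : S * T + T * S' = 0 := by
      rw [hT, Matrix.mul_sub, Matrix.sub_mul, h0]; abel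
    have h2 : (S - 2 • 1) * T + T * (S' - 2 • 1) = (S * T + T * S') - (4 : ℝ) • T := by
      simp only [Matrix.sub_mul, Matrix.mul_sub, Matrix.smul_mul, Matrix.mul_smul, Matrix.one_mul,
        Matrix.mul_one]
      module
    rw [h2, this]; simp
  have hle : 4 * ‖T‖ ≤ ‖S - 2 • 1‖ * ‖T‖ + ‖T‖ * ‖S' - 2 • 1‖ := by
    have := congrArg norm e
    rw [norm_smul, norm_neg] at this
    calc 4 * ‖T‖ = ‖(S - 2 • 1) * T + T * (S' - 2 • 1)‖ := by rw [← this]; norm_num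
      _ ≤ _ := (norm_add_le _ _).trans
        (add_le_add (frobenius_norm_mul _ _) (frobenius_norm_mul _ _))
  have hT0 : T = 0 := by
    by_contra hne
    have hpos := norm_pos_iff.2 hne
    nlinarith [hnorm R h, hnorm R' h']
  have hSS : R + Rᵀ = R' + R'ᵀ := sub_eq_zero.1 hT0
  have : (2 : ℝ) • R = (2 : ℝ) • R' := by
    calc (2 : ℝ) • R = (R + Rᵀ) + (R - Rᵀ) := by module
      _ = (R' + R'ᵀ) + (R' - R'ᵀ) := by rw [hSS, hK]
      _ = (2 : ℝ) • R' := by module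
  exact smul_right_injective _ two_ne_zero this

/-- First order condition for the middle point of a three-term chain. -/
theorem symm_of_forall_norm_le {P Q R : Matrix (Fin n) (Fin n) ℝ} (hQ : Q ∈ St n n)
    (hmin : ∀ Q' ∈ St n n, ‖Q - P‖ ^ 2 + ‖R - Q‖ ^ 2 ≤ ‖Q' - P‖ ^ 2 + ‖R - Q'‖ ^ 2) :
    (Qᵀ * (P + R))ᵀ = Qᵀ * (P + R) := by
  set M := Qᵀ * (P + R) with hM
  set D := M - Mᵀ with hD
  have hDs : Dᵀ = -D := by rw [hD, transpose_sub, transpose_transpose]; abel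
  -- All orthogonal matrices have the same norm, so minimising the sum of squares is maximising a
  -- linear function of `Q'`.
  have key : ∀ Q' ∈ St n n, (Q'ᵀ * (P + R)).trace ≤ (Qᵀ * (P + R)).trace := by
    intro Q' hQ'
    have := hmin Q' hQ'
    simp only [norm_sub_sq_eq, norm_of_mem_St hQ, norm_of_mem_St hQ'] at this
    rw [trace_transpose_mul_comm R Q, trace_transpose_mul_comm R Q'] at this
    simp only [Matrix.mul_add, trace_add]
    linarith
  -- Variation in the direction of the skew part `D` of `M` itself: the derivative is `tr (Dᵀ M) =
  -- ‖D‖² / 2`, and it vanishes at the maximum.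
  have hder : HasDerivAt (fun s : ℝ => ((Q * exp (s • D))ᵀ * (P + R)).trace)
      ((Q * D)ᵀ * (P + R)).trace 0 := by
    have h1 := hasDerivAt_exp_smul D 0
    rw [zero_smul, exp_zero, Matrix.one_mul] at h1
    have hL : ∃ L : Matrix (Fin n) (Fin n) ℝ →L[ℝ] ℝ,
        ∀ X, L X = ((Q * X)ᵀ * (P + R)).trace := by
      refine ⟨LinearMap.toContinuousLinearMap
        { toFun := fun X => ((Q * X)ᵀ * (P + R)).trace
          map_add' := fun X Y => by simp [Matrix.mul_add, Matrix.add_mul]; ring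
          map_smul' := fun c X => by simp }, fun X => rfl⟩
    obtain ⟨L, hL⟩ := hL
    have := L.hasFDerivAt.comp_hasDerivAt (0 : ℝ) h1
    simp only [Function.comp_def, hL] at this
    exact this.congr_deriv (hL D)
  have hmax : IsLocalMax (fun s : ℝ => ((Q * exp (s • D))ᵀ * (P + R)).trace) 0 := by
    refine Eventually.of_forall fun s => ?_
    have := key _ (mul_mem_St hQ (exp_skew_mem_St (skew_smul hDs s)))
    simpa using this
  have h0 := hmax.hasDerivAt_eq_zero hder
  rw [transpose_mul, Matrix.mul_assoc, ← hM] at h0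
  have h1 : ‖D‖ ^ 2 = (Dᵀ * M).trace - (Dᵀ * Mᵀ).trace := by
    rw [norm_sq_eq_trace, ← trace_sub, ← Matrix.mul_sub]
  have h2 : (Dᵀ * Mᵀ).trace = -(Dᵀ * M).trace := by
    rw [← transpose_mul, trace_transpose, trace_mul_comm, hDs, Matrix.neg_mul, trace_neg, neg_neg]
  have h3 : ‖D‖ ^ 2 = 0 := by rw [h1, h2, h0]; simp
  have h4 : D = 0 := norm_eq_zero.1 (pow_eq_zero_iff two_ne_zero |>.1 h3)
  exact (sub_eq_zero.1 h4).symm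

/-- A chain in the orthogonal group with small steps can be replaced by a chain with constant
rotation that is not longer. -/
theorem exists_root_of_chain {P : Matrix (Fin n) (Fin n) ℝ} {ℓ : ℝ} {N : ℕ} (hℓ : 0 ≤ ℓ)
    (hN : ℓ ^ 2 < N) {q : ℕ → Matrix (Fin n) (Fin n) ℝ} (hq : ∀ i, q i ∈ St n n) (hq0 : q 0 = 1)
    (hqN : q N = P) (hstep : ∀ i < N, ‖q (i + 1) - q i‖ ≤ ℓ / N) :
    ∃ R ∈ St n n, R ^ N = P ∧ ‖R - 1‖ ≤ ℓ / N := by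
  have hNpos : (0 : ℝ) < N := (sq_nonneg ℓ).trans_lt hN
  -- The energy is minimised over chains with fixed ends, a compact set by Tychonoff; criticality
  -- makes the steps `R i` of the minimiser all equal.
  let E : (ℕ → Matrix (Fin n) (Fin n) ℝ) → ℝ := fun Q => ∑ i ∈ Finset.range N, ‖Q (i + 1) - Q i‖ ^ 2
  let K : Set (ℕ → Matrix (Fin n) (Fin n) ℝ) :=
    {Q | (∀ i, Q i ∈ St n n) ∧ Q 0 = 1 ∧ Q N = P}
  have hK : IsCompact K := by
    have h1 : IsCompact {Q : ℕ → Matrix (Fin n) (Fin n) ℝ | ∀ i, Q i ∈ St n n} :=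
      isCompact_pi_infinite fun _ => isCompact_St
    refine h1.of_isClosed_subset ?_ fun Q hQ => hQ.1
    refine h1.isClosed.inter ?_
    exact (isClosed_eq (continuous_apply 0) continuous_const).inter
      (isClosed_eq (continuous_apply N) continuous_const)
  have hE : Continuous E := by
    refine continuous_finsetSum _ fun i _ => ?_
    exact ((continuous_apply (i + 1)).sub (continuous_apply i)).norm.pow 2
  obtain ⟨Q, hQK, hQmin⟩ := hK.exists_isMinOn ⟨q, hq, hq0, hqN⟩ hE.continuousOn
  obtain ⟨hQ, hQ0, hQN⟩ := hQK
  have hEQ : E Q ≤ ℓ ^ 2 / N := by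
    refine (hQmin (show q ∈ K from ⟨hq, hq0, hqN⟩)).trans ?_
    calc E q ≤ ∑ i ∈ Finset.range N, (ℓ / N) ^ 2 :=
          Finset.sum_le_sum fun i hi => by
            have := hstep i (Finset.mem_range.1 hi)
            gcongr
      _ = ℓ ^ 2 / N := by
          rw [Finset.sum_const, Finset.card_range, nsmul_eq_mul]; field_simp
  set R : ℕ → Matrix (Fin n) (Fin n) ℝ := fun i => (Q i)ᵀ * Q (i + 1) with hR
  have hRmem : ∀ i, R i ∈ St n n := fun i => mul_mem_St (transpose_mem_St (hQ i)) (hQ (i + 1))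
  have hRnorm : ∀ i, ‖R i - 1‖ = ‖Q (i + 1) - Q i‖ := by
    intro i
    rw [← norm_mul_left_of_mem_St (transpose_mem_St (hQ i)) (Q (i + 1) - Q i), Matrix.mul_sub,
      mem_St.1 (hQ i)]
  -- Here `ℓ ^ 2 < N` is used: the total energy is below 1, hence so is each step, as
  -- `eq_of_skewPart_eq` requires.
  have hRlt : ∀ i < N, ‖R i - 1‖ < 1 := by
    intro i hi
    have h1 : ‖R i - 1‖ ^ 2 ≤ E Q := by
      rw [hRnorm]
      exact Finset.single_le_sum (f := fun i => ‖Q (i + 1) - Q i‖ ^ 2) (fun _ _ => sq_nonneg _)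
        (Finset.mem_range.2 hi)
    have h2 : ℓ ^ 2 / N < 1 := (div_lt_one hNpos).2 hN
    refine lt_of_pow_lt_pow_left₀ 2 zero_le_one ?_
    rw [one_pow]; linarith
  have hconst : ∀ i, i + 1 < N → R (i + 1) = R i := by
    intro i hi
    refine eq_of_skewPart_eq (hRmem _) (hRmem _) (hRlt _ hi) (hRlt _ (by omega)) ?_
    -- Varying only the vertex `i + 1` shows that `(R i)ᵀ + R (i + 1)` is symmetric, that is, `R i`
    -- and `R (i + 1)` have the same skew part.
    have hs := symm_of_forall_norm_le (P := Q i) (R := Q (i + 2)) (hQ (i + 1)) fun Q' hQ' => by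
      let Z := Function.update Q (i + 1) Q'
      have hZ : Z ∈ K := by
        refine ⟨fun j => ?_, ?_, ?_⟩
        · by_cases hj : j = i + 1
          · subst hj; simpa [Z] using hQ'
          · simpa [Z, hj] using hQ j
        · simpa [Z, Function.update_of_ne (show 0 ≠ i + 1 by omega)] using hQ0
        · simpa [Z, Function.update_of_ne (show N ≠ i + 1 by omega)] using hQN
      have hle := hQmin hZ
      have hsplit : ∀ W : ℕ → Matrix (Fin n) (Fin n) ℝ,
          E W = ‖W (i + 1) - W i‖ ^ 2 + ‖W (i + 2) - W (i + 1)‖ ^ 2 +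
            ∑ j ∈ (Finset.range N \ {i, i + 1}), ‖W (j + 1) - W j‖ ^ 2 := by
        intro W
        have hsub : ({i, i + 1} : Finset ℕ) ⊆ Finset.range N := by
          intro j hj
          simp only [Finset.mem_insert, Finset.mem_singleton] at hj
          rw [Finset.mem_range]; omega
        show ∑ j ∈ Finset.range N, ‖W (j + 1) - W j‖ ^ 2 = _
        rw [← Finset.sum_sdiff hsub, Finset.sum_pair (by omega)]
        ring
      have hrest : ∑ j ∈ (Finset.range N \ {i, i + 1}), ‖Z (j + 1) - Z j‖ ^ 2
          = ∑ j ∈ (Finset.range N \ {i, i + 1}), ‖Q (j + 1) - Q j‖ ^ 2 := by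
        refine Finset.sum_congr rfl fun j hj => ?_
        simp only [Finset.mem_sdiff, Finset.mem_insert, Finset.mem_singleton, not_or] at hj
        have e1 : Z (j + 1) = Q (j + 1) := Function.update_of_ne (by omega) _ _
        have e2 : Z j = Q j := Function.update_of_ne (by omega) _ _
        rw [e1, e2]
      have hle' : E Q ≤ E Z := hle
      rw [hsplit Q, hsplit Z, hrest] at hle'
      have e1 : Z (i + 1) = Q' := Function.update_self _ _ _
      have e2 : Z i = Q i := Function.update_of_ne (by omega) _ _
      have e3 : Z (i + 2) = Q (i + 2) := Function.update_of_ne (by omega) _ _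
      rw [e1, e2, e3] at hle'
      linarith
    have hRi : (Q (i + 1))ᵀ * Q i = (R i)ᵀ := by simp [hR]
    have hRi1 : (Q (i + 1))ᵀ * Q (i + 2) = R (i + 1) := rfl
    rw [Matrix.mul_add, hRi, hRi1, transpose_add, transpose_transpose] at hs
    rw [sub_eq_sub_iff_add_eq_add, add_comm (R (i + 1)), hs.symm, add_comm]
  have hR0 : ∀ i < N, R i = R 0 := by
    intro i
    induction i with
    | zero => intro _; rfl
    | succ i ih => intro hi; rw [hconst i hi, ih (by omega)]
  have hpow : ∀ i ≤ N, Q i = R 0 ^ i := by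
    intro i
    induction i with
    | zero => intro _; rw [hQ0, pow_zero]
    | succ i ih =>
      intro hi
      rw [pow_succ, ← ih (by omega), ← hR0 i (by omega), hR]
      simp only
      rw [← Matrix.mul_assoc, mul_transpose_of_mem_St (hQ i), Matrix.one_mul]
  refine ⟨R 0, hRmem 0, by rw [← hpow N le_rfl, hQN], ?_⟩
  have hE0 : E Q = N * ‖R 0 - 1‖ ^ 2 := by
    show ∑ i ∈ Finset.range N, ‖Q (i + 1) - Q i‖ ^ 2 = _
    rw [Finset.sum_congr rfl fun i hi => by
      rw [← hRnorm, hR0 i (Finset.mem_range.1 hi)], Finset.sum_const, Finset.card_range,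
      nsmul_eq_mul]
  refine le_of_sq_le_sq ?_ (by positivity)
  rw [hE0] at hEQ
  rw [div_pow, le_div_iff₀ (by positivity)]
  rw [le_div_iff₀ hNpos] at hEQ
  nlinarith

theorem pow_mem_St {R : Matrix (Fin n) (Fin n) ℝ} (hR : R ∈ St n n) (k : ℕ) : R ^ k ∈ St n n := by
  induction k with
  | zero => rw [pow_zero]; exact one_mem_St
  | succ k ih => rw [pow_succ]; exact mul_mem_St ih hR

/-- Telescoping, with orthogonal factors that do not change norms. It controls the error when a root
of `P` is replaced by an exponential. -/
theorem norm_pow_sub_pow_le {R Y : Matrix (Fin n) (Fin n) ℝ} (hR : R ∈ St n n) (hY : Y ∈ St n n)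
    (k : ℕ) : ‖R ^ k - Y ^ k‖ ≤ k * ‖R - Y‖ := by
  induction k with
  | zero => simp
  | succ k ih =>
    have : R ^ (k + 1) - Y ^ (k + 1) = R ^ k * (R - Y) + (R ^ k - Y ^ k) * Y := by
      rw [pow_succ, pow_succ]; noncomm_ring
    rw [this]
    refine (norm_add_le _ _).trans ?_
    rw [norm_mul_left_of_mem_St (pow_mem_St hR k), norm_mul_right_of_mem_St hY]
    push_cast
    linarith

/-- A path of length `ℓ` in the orthogonal group can be replaced by a one-parameter subgroup that is
not longer. -/
theorem exists_skew_exp_of_path {P : Matrix (Fin n) (Fin n) ℝ} {ℓ : ℝ} (hℓ : 0 ≤ ℓ)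
    {f : ℝ → Matrix (Fin n) (Fin n) ℝ} (hf : ∀ t, f t ∈ St n n) (hf0 : f 0 = 1) (hfℓ : f ℓ = P)
    (hlip : ∀ s t, s ≤ t → ‖f t - f s‖ ≤ t - s) :
    ∃ A : Matrix (Fin n) (Fin n) ℝ, Aᵀ = -A ∧ exp A = P ∧ ‖A‖ ≤ ℓ := by
  obtain ⟨M, hM⟩ := exists_nat_gt (ℓ ^ 2)
  -- Chains with `M + k` links satisfy the hypothesis of `exists_root_of_chain` for every `k`.
  have hMN : ∀ k : ℕ, ℓ ^ 2 < ((M + k : ℕ) : ℝ) := fun k => by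
    push_cast; linarith [k.cast_nonneg (α := ℝ)]
  have hpos : ∀ k : ℕ, (0 : ℝ) < ((M + k : ℕ) : ℝ) := fun k => (sq_nonneg ℓ).trans_lt (hMN k)
  have hex : ∀ k : ℕ, ∃ R ∈ St n n, R ^ (M + k) = P ∧ ‖R - 1‖ ≤ ℓ / (M + k : ℕ) := by
    intro k
    refine exists_root_of_chain hℓ (hMN k) (q := fun i => f (i * (ℓ / (M + k : ℕ))))
      (fun i => hf _) (by simpa using hf0) ?_ fun i _ => ?_
    · rw [mul_div_cancel₀ _ (hpos k).ne', hfℓ]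
    · have h0 : 0 ≤ ℓ / (M + k : ℕ) := div_nonneg hℓ (hpos k).le
      refine (hlip _ _ ?_).trans (le_of_eq ?_)
      · push_cast at h0 ⊢; nlinarith
      · push_cast; ring
  choose R hR hRP hRn using hex
  -- With N = M + k, `N (R - 1)` is an approximate logarithm of `P = R ^ N` and is bounded by `ℓ`; a
  -- limit point will be an exact one.
  let A : ℕ → Matrix (Fin n) (Fin n) ℝ := fun k => ((M + k : ℕ) : ℝ) • (R k - 1)
  have hA : ∀ k, A k ∈ Metric.closedBall (0 : Matrix (Fin n) (Fin n) ℝ) ℓ := by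
    intro k
    rw [mem_closedBall_zero_iff, norm_smul, Real.norm_of_nonneg (hpos k).le]
    have := hRn k
    rwa [le_div_iff₀' (hpos k)] at this
  obtain ⟨B, hB, φ, hφ, hlim⟩ := (isCompact_closedBall _ _).tendsto_subseq hA
  have hNat : Tendsto (fun k : ℕ => ((M + k : ℕ) : ℝ)) atTop atTop :=
    tendsto_natCast_atTop_atTop.comp (tendsto_add_atTop_nat M |>.congr fun k => by rw [add_comm])
  have hNφ := hNat.comp hφ.tendsto_atTop
  have hBs : Bᵀ = -B := by
    have h1 : Tendsto (fun k => A (φ k) + (A (φ k))ᵀ) atTop (𝓝 (B + Bᵀ)) := by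
      refine hlim.add ?_
      exact ((continuous_id.matrix_transpose).tendsto B).comp hlim
    have h2 : Tendsto (fun k => A (φ k) + (A (φ k))ᵀ) atTop (𝓝 0) := by
      refine squeeze_zero_norm (a := fun k => ℓ ^ 2 / ((M + φ k : ℕ) : ℝ)) (fun k => ?_)
        (tendsto_const_nhds.div_atTop hNφ)
      set j := φ k
      -- Orthogonality makes the symmetric part quadratic in `R - 1`, hence of order 1/N.
      have e : A j + (A j)ᵀ = -(((M + j : ℕ) : ℝ) • ((R j - 1)ᵀ * (R j - 1))) := by
        have h := mem_St.1 (hR j)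
        simp only [A, transpose_smul, transpose_sub, transpose_one, Matrix.sub_mul, Matrix.mul_sub,
          h, Matrix.one_mul, Matrix.mul_one]
        module
      rw [e, norm_neg, norm_smul, Real.norm_of_nonneg (hpos j).le]
      calc ((M + j : ℕ) : ℝ) * ‖(R j - 1)ᵀ * (R j - 1)‖
          ≤ ((M + j : ℕ) : ℝ) * (ℓ / (M + j : ℕ) * (ℓ / (M + j : ℕ))) := by
            have h := frobenius_norm_mul (R j - 1)ᵀ (R j - 1)
            rw [frobenius_norm_transpose] at h
            have h' := hRn j
            have := hpos j
            gcongr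
            exact h.trans (by gcongr)
        _ = ℓ ^ 2 / ((M + j : ℕ) : ℝ) := by field_simp [(hpos j).ne']
    have := tendsto_nhds_unique h1 h2
    rw [eq_neg_iff_add_eq_zero, add_comm]; exact this
  refine ⟨B, hBs, ?_, by simpa using hB⟩
  · have hder := hasDerivAt_iff_tendsto_slope_zero.1 (hasDerivAt_exp_smul B 0)
    have hinv : Tendsto (fun k : ℕ => (((M + φ k : ℕ) : ℝ))⁻¹) atTop (𝓝[≠] 0) := by
      refine tendsto_nhdsWithin_iff.2 ⟨tendsto_inv_atTop_zero.comp hNφ, Eventually.of_forall ?_⟩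
      intro k; exact inv_ne_zero (hpos _).ne'
    have hs := hder.comp hinv
    simp only [zero_smul, exp_zero, Matrix.one_mul, zero_add, Function.comp_def, inv_inv] at hs
    have hdiff := (hlim.sub hs).norm
    rw [sub_self, norm_zero] at hdiff
    -- Compare `P = R ^ N` with `exp B = exp (B / N) ^ N`; the bound tends to 0 because `N (R - 1)`
    -- and `N (exp (B / N) - 1)` both tend to `B`.
    have hle : ∀ k, ‖P - exp B‖ ≤
        ‖A (φ k) - ((M + φ k : ℕ) : ℝ) • (exp ((((M + φ k : ℕ) : ℝ))⁻¹ • B) - 1)‖ := by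
      intro k
      have hY := exp_skew_mem_St (skew_smul hBs (((M + φ k : ℕ) : ℝ))⁻¹)
      have h := norm_pow_sub_pow_le (hR (φ k)) hY (M + φ k)
      rw [hRP, ← Matrix.exp_nsmul, ← Nat.cast_smul_eq_nsmul ℝ, smul_smul,
        mul_inv_cancel₀ (hpos _).ne', one_smul] at h
      refine h.trans (le_of_eq ?_)
      rw [← smul_sub, norm_smul, Real.norm_of_nonneg (hpos _).le]
      congr 2; abel
    have := ge_of_tendsto' hdiff hle
    have h0 := norm_le_zero_iff.1 this
    exact (sub_eq_zero.1 h0).symm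

/-- The triangle inequality for the norms of the logarithms of orthogonal matrices. -/
theorem exists_exp_eq_mul {A B : Matrix (Fin n) (Fin n) ℝ} (hA : Aᵀ = -A) (hB : Bᵀ = -B) :
    ∃ C : Matrix (Fin n) (Fin n) ℝ, Cᵀ = -C ∧ exp C = exp A * exp B ∧ ‖C‖ ≤ ‖A‖ + ‖B‖ := by
  have hunit : ∀ X : Matrix (Fin n) (Fin n) ℝ, ‖X‖ • ‖X‖⁻¹ • X = X := by
    intro X
    by_cases h : X = 0
    · simp [h]
    · rw [smul_smul, mul_inv_cancel₀ (norm_ne_zero_iff.2 h), one_smul]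
  have hle1 : ∀ X : Matrix (Fin n) (Fin n) ℝ, ‖‖X‖⁻¹ • X‖ ≤ 1 := by
    intro X
    rw [norm_smul, norm_inv, norm_norm]
    exact inv_mul_le_one
  have hbd : ∀ X : Matrix (Fin n) (Fin n) ℝ, Xᵀ = -X → ∀ s t, s ≤ t →
      ‖exp (t • ‖X‖⁻¹ • X) - exp (s • ‖X‖⁻¹ • X)‖ ≤ t - s := by
    intro X hX s t hst
    refine (norm_exp_smul_sub_le (skew_smul hX _) s t).trans ?_
    rw [abs_of_nonneg (sub_nonneg.2 hst)]
    exact mul_le_of_le_one_left (sub_nonneg.2 hst) (hle1 X)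
  have hAs : ∀ t : ℝ, exp (t • ‖A‖⁻¹ • A) ∈ St n n :=
    fun t => exp_skew_mem_St (skew_smul (skew_smul hA _) t)
  have hBs : ∀ t : ℝ, exp (t • ‖B‖⁻¹ • B) ∈ St n n :=
    fun t => exp_skew_mem_St (skew_smul (skew_smul hB _) t)
  refine exists_skew_exp_of_path (by positivity)
    -- The broken path: along `A` for time `‖A‖`, then along `B`, each at unit speed. If `A` or `B`
    -- vanishes, the convention `0⁻¹ = 0` makes its factor constant.
    (f := fun t => exp (min t ‖A‖ • ‖A‖⁻¹ • A) * exp (max (t - ‖A‖) 0 • ‖B‖⁻¹ • B))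
    (fun t => mul_mem_St (hAs _) (hBs _)) ?_ ?_ fun s t hst => ?_
  · simp
  · simp only [add_sub_cancel_left]
    rw [min_eq_right (by linarith [norm_nonneg B]), max_eq_left (norm_nonneg B), hunit, hunit]
  · set a := min s ‖A‖
    set a' := min t ‖A‖
    set b := max (s - ‖A‖) 0
    set b' := max (t - ‖A‖) 0
    have ha : a ≤ a' := min_le_min_right _ hst
    have hb : b ≤ b' := max_le_max_right _ (by linarith)
    have e : exp (a' • ‖A‖⁻¹ • A) * exp (b' • ‖B‖⁻¹ • B) - exp (a • ‖A‖⁻¹ • A) * exp (b • ‖B‖⁻¹ • B)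
        = exp (a' • ‖A‖⁻¹ • A) * (exp (b' • ‖B‖⁻¹ • B) - exp (b • ‖B‖⁻¹ • B))
          + (exp (a' • ‖A‖⁻¹ • A) - exp (a • ‖A‖⁻¹ • A)) * exp (b • ‖B‖⁻¹ • B) := by noncomm_ring
    rw [e]
    refine (norm_add_le _ _).trans ?_
    rw [norm_mul_left_of_mem_St (hAs _), norm_mul_right_of_mem_St (hBs _)]
    have h1 := hbd A hA a a' ha
    have h2 := hbd B hB b b' hb
    have h3 : ∀ x : ℝ, min x ‖A‖ + max (x - ‖A‖) 0 = x := by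
      intro x
      rcases le_total x ‖A‖ with h | h
      · rw [min_eq_left h, max_eq_right (by linarith), add_zero]
      · rw [min_eq_right h, max_eq_left (by linarith)]; ring
    have := h3 s
    have := h3 t
    linarith

/-! ### Horizontal lifts and the canonical metric -/

/-- The horizontal skew-symmetric matrix `Ω` with `Ω U = X`, for a tangent vector `X` at `U`. -/
def hor (U : Matrix (Fin n) (Fin p) ℝ) :
    Matrix (Fin n) (Fin p) ℝ →ₗ[ℝ] Matrix (Fin n) (Fin n) ℝ where
  toFun X := X * Uᵀ - U * Xᵀ - U * Uᵀ * X * Uᵀ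
  map_add' X Y := by
    simp only [Matrix.add_mul, Matrix.mul_add, transpose_add]; abel
  map_smul' c X := by
    simp only [Matrix.smul_mul, Matrix.mul_smul, transpose_smul, RingHom.id_apply, smul_sub]

theorem hor_apply (U X : Matrix (Fin n) (Fin p) ℝ) :
    hor U X = X * Uᵀ - U * Xᵀ - U * Uᵀ * X * Uᵀ := rfl

theorem mem_tangent {U X : Matrix (Fin n) (Fin p) ℝ} :
    X ∈ tangent U ↔ Uᵀ * X = -(Xᵀ * U) := Iff.rfl

theorem smul_mem_tangent {U X : Matrix (Fin n) (Fin p) ℝ} (hX : X ∈ tangent U) (c : ℝ) :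
    c • X ∈ tangent U := by
  rw [mem_tangent] at *
  simp [hX]

theorem skew_mul_mem_tangent {A : Matrix (Fin n) (Fin n) ℝ} (hA : Aᵀ = -A)
    (U : Matrix (Fin n) (Fin p) ℝ) : A * U ∈ tangent U := by
  rw [mem_tangent, transpose_mul, hA, Matrix.mul_neg, Matrix.neg_mul, neg_neg, Matrix.mul_assoc]

theorem hor_transpose {U X : Matrix (Fin n) (Fin p) ℝ} (hX : X ∈ tangent U) :
    (hor U X)ᵀ = -hor U X := by
  have h : (U * Uᵀ * X * Uᵀ)ᵀ = -(U * Uᵀ * X * Uᵀ) := by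
    rw [Matrix.mul_assoc U, mem_tangent.1 hX]
    simp only [transpose_mul, transpose_transpose, Matrix.mul_neg, Matrix.neg_mul, neg_neg,
      transpose_neg]
    rw [mem_tangent.1 hX]
    simp [Matrix.mul_assoc]
  rw [hor_apply, transpose_sub, h]
  simp only [transpose_sub, transpose_mul, transpose_transpose]
  abel

theorem hor_mul_self {U X : Matrix (Fin n) (Fin p) ℝ} (hU : U ∈ St n p) (hX : X ∈ tangent U) :
    hor U X * U = X := by
  have h1 := mem_St.1 hU
  have h2 := mem_tangent.1 hX
  have h3 : Xᵀ * U = -(Uᵀ * X) := by rw [h2, neg_neg]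
  rw [hor_apply, Matrix.sub_mul, Matrix.sub_mul, Matrix.mul_assoc X, h1, Matrix.mul_one,
    Matrix.mul_assoc _ Uᵀ U, h1, Matrix.mul_one, Matrix.mul_assoc U Xᵀ, h3, Matrix.mul_assoc U Uᵀ X,
    Matrix.mul_neg]
  abel

/-- Duality behind horizontality: `hor U X` pairs with a skew `S` only through `S * U`, so it is
orthogonal to every skew matrix killing `U`. Taking `S = hor U X` gives the norm formula for tangent
vectors. -/
theorem trace_hor_transpose_mul (U X : Matrix (Fin n) (Fin p) ℝ) {S : Matrix (Fin n) (Fin n) ℝ}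
    (hS : Sᵀ = -S) : ((hor U X)ᵀ * S).trace = 2 * canonicalMetric U X (S * U) := by
  have e1 : (U * Xᵀ * S).trace = (Xᵀ * S * U).trace := by
    rw [Matrix.mul_assoc, trace_mul_comm]
  have e2 : (X * Uᵀ * S).trace = -(Xᵀ * S * U).trace := by
    rw [← trace_transpose, transpose_mul, hS, transpose_mul, transpose_transpose, Matrix.neg_mul,
      trace_neg, trace_mul_comm, e1]
  have e3 : (U * (Xᵀ * U * Uᵀ) * S).trace = (Xᵀ * U * Uᵀ * S * U).trace := by
    rw [Matrix.mul_assoc, trace_mul_comm]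
  have e4 : (hor U X)ᵀ = U * Xᵀ - X * Uᵀ - U * (Xᵀ * U * Uᵀ) := by
    rw [hor_apply]
    simp only [transpose_sub, transpose_mul, transpose_transpose, Matrix.mul_assoc]
  rw [e4, Matrix.sub_mul, Matrix.sub_mul, trace_sub, trace_sub, e1, e2, e3, canonicalMetric]
  simp only [Matrix.mul_sub, Matrix.sub_mul, Matrix.mul_one, Matrix.mul_smul, Matrix.smul_mul,
    trace_sub, trace_smul, smul_eq_mul, Matrix.mul_assoc]
  ring

theorem canonicalMetric_self {U X : Matrix (Fin n) (Fin p) ℝ} (hU : U ∈ St n p)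
    (hX : X ∈ tangent U) : canonicalMetric U X X = ‖hor U X‖ ^ 2 / 2 := by
  have h := trace_hor_transpose_mul U X (hor_transpose hX)
  rw [← norm_sq_eq_trace, hor_mul_self hU hX] at h
  linarith

theorem tangentNorm_eq {U X : Matrix (Fin n) (Fin p) ℝ} (hU : U ∈ St n p)
    (hX : X ∈ tangent U) : tangentNorm U X = ‖hor U X‖ / √2 := by
  rw [tangentNorm, canonicalMetric_self hU hX, Real.sqrt_div (sq_nonneg _),
    Real.sqrt_sq (norm_nonneg _)]

/-- Pythagoras: the remainder `A - hor U (A * U)` is skew and kills `U`. -/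
theorem norm_sq_eq_hor_add {U : Matrix (Fin n) (Fin p) ℝ} (hU : U ∈ St n p)
    {A : Matrix (Fin n) (Fin n) ℝ} (hA : Aᵀ = -A) :
    ‖A‖ ^ 2 = ‖hor U (A * U)‖ ^ 2 + ‖A - hor U (A * U)‖ ^ 2 := by
  have hX := skew_mul_mem_tangent hA U
  have hK : (A - hor U (A * U))ᵀ = -(A - hor U (A * U)) := by
    rw [transpose_sub, hA, hor_transpose hX]; abel
  have h := trace_hor_transpose_mul U (A * U) hK
  rw [Matrix.sub_mul, hor_mul_self hU hX, sub_self, canonicalMetric, Matrix.mul_zero, trace_zero,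
    mul_zero] at h
  have h2 := norm_add_sq_eq (hor U (A * U)) (A - hor U (A * U))
  rw [h, add_sub_cancel] at h2
  linarith

theorem norm_hor_le {U : Matrix (Fin n) (Fin p) ℝ} (hU : U ∈ St n p)
    {A : Matrix (Fin n) (Fin n) ℝ} (hA : Aᵀ = -A) : ‖hor U (A * U)‖ ≤ ‖A‖ := by
  refine le_of_sq_le_sq ?_ (norm_nonneg _)
  rw [norm_sq_eq_hor_add hU hA]
  nlinarith [sq_nonneg ‖A - hor U (A * U)‖]

theorem eq_hor_of_norm_le {U : Matrix (Fin n) (Fin p) ℝ} (hU : U ∈ St n p)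
    {A : Matrix (Fin n) (Fin n) ℝ} (hA : Aᵀ = -A) (h : ‖A‖ ≤ ‖hor U (A * U)‖) :
    A = hor U (A * U) := by
  have h1 := norm_sq_eq_hor_add hU hA
  have h2 : ‖A‖ ^ 2 ≤ ‖hor U (A * U)‖ ^ 2 := by gcongr
  have h3 : ‖A - hor U (A * U)‖ ^ 2 = 0 := le_antisymm (by linarith) (sq_nonneg _)
  exact sub_eq_zero.1 (norm_eq_zero.1 (pow_eq_zero_iff two_ne_zero |>.1 h3))

theorem hor_mul_left {Q : Matrix (Fin n) (Fin n) ℝ} (hQ : Q ∈ St n n)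
    (U X : Matrix (Fin n) (Fin p) ℝ) : hor (Q * U) (Q * X) = Q * hor U X * Qᵀ := by
  have h : Q * U * (Q * U)ᵀ * (Q * X) * (Q * U)ᵀ = Q * (U * Uᵀ * X * Uᵀ) * Qᵀ := by
    rw [transpose_mul]
    have : Q * U * (Uᵀ * Qᵀ) * (Q * X) = Q * U * Uᵀ * (Qᵀ * Q) * X := by
      simp only [Matrix.mul_assoc]
    rw [this, mem_St.1 hQ]
    simp only [Matrix.mul_assoc, Matrix.one_mul]
  rw [hor_apply, h, hor_apply]
  simp only [transpose_mul, Matrix.mul_sub, Matrix.sub_mul, Matrix.mul_assoc]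

theorem mul_mem_tangent {Q : Matrix (Fin n) (Fin n) ℝ} (hQ : Q ∈ St n n)
    {U X : Matrix (Fin n) (Fin p) ℝ} (hX : X ∈ tangent U) : Q * X ∈ tangent (Q * U) := by
  rw [mem_tangent, transpose_mul, transpose_mul, Matrix.mul_assoc, ← Matrix.mul_assoc Qᵀ,
    mem_St.1 hQ, Matrix.one_mul, mem_tangent.1 hX, Matrix.mul_assoc, ← Matrix.mul_assoc Qᵀ,
    mem_St.1 hQ, Matrix.one_mul]

/-! ### The exponential map near zero -/

/-- The symmetric part of `Uᵀ X`. -/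
noncomputable def symPart (U : Matrix (Fin n) (Fin p) ℝ) :
    Matrix (Fin n) (Fin p) ℝ →ₗ[ℝ] Matrix (Fin p) (Fin p) ℝ where
  toFun X := (1 / 2 : ℝ) • (Uᵀ * X + Xᵀ * U)
  map_add' X Y := by
    simp only [Matrix.add_mul, Matrix.mul_add, transpose_add]; module
  map_smul' c X := by
    simp only [Matrix.smul_mul, Matrix.mul_smul, transpose_smul, RingHom.id_apply]; module

theorem symPart_apply (U X : Matrix (Fin n) (Fin p) ℝ) :
    symPart U X = (1 / 2 : ℝ) • (Uᵀ * X + Xᵀ * U) := rfl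

theorem symPart_transpose (U X : Matrix (Fin n) (Fin p) ℝ) :
    (symPart U X)ᵀ = symPart U X := by
  simp only [symPart_apply, transpose_smul, transpose_add, transpose_mul, transpose_transpose]
  rw [add_comm]

theorem symPart_eq_zero_iff {U X : Matrix (Fin n) (Fin p) ℝ} :
    symPart U X = 0 ↔ X ∈ tangent U := by
  rw [symPart_apply, smul_eq_zero_iff_right (by norm_num), mem_tangent, eq_neg_iff_add_eq_zero]

theorem sub_symPart_mem_tangent {U : Matrix (Fin n) (Fin p) ℝ} (hU : U ∈ St n p)
    (X : Matrix (Fin n) (Fin p) ℝ) : X - U * symPart U X ∈ tangent U := by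
  have h1 := mem_St.1 hU
  rw [mem_tangent, transpose_sub, transpose_mul, symPart_transpose, Matrix.mul_sub, Matrix.sub_mul,
    Matrix.mul_assoc _ Uᵀ, ← Matrix.mul_assoc Uᵀ U, h1, Matrix.mul_one, Matrix.one_mul,
    symPart_apply]
  module

/-- A local diffeomorphism of the ambient space that extends the exponential map of `St(n,p)`
at `U`. -/
noncomputable def ambientExp (U X : Matrix (Fin n) (Fin p) ℝ) : Matrix (Fin n) (Fin p) ℝ :=
  exp (hor U (X - U * symPart U X)) * (U + U * symPart U X)

theorem ambientExp_of_mem_tangent {U X : Matrix (Fin n) (Fin p) ℝ} (hX : X ∈ tangent U) :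
    ambientExp U X = exp (hor U X) * U := by
  simp [ambientExp, symPart_eq_zero_iff.2 hX]

/-- The exponential factor is orthogonal, so membership reads `(1 + S)² = 1` for `S = symPart U X`.
Then `2 S = -S²`, which forces `S = 0` once `‖S‖ < 2`. -/
theorem mem_tangent_of_ambientExp_mem_St {U X : Matrix (Fin n) (Fin p) ℝ} (hU : U ∈ St n p)
    (h : ambientExp U X ∈ St n p) (hX : ‖symPart U X‖ < 2) : X ∈ tangent U := by
  rw [← symPart_eq_zero_iff]
  set S := symPart U X with hS
  have hE := exp_skew_mem_St (hor_transpose (sub_symPart_mem_tangent hU X))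
  have e1 : (U + U * S)ᵀ * (U + U * S) = 1 := by
    have := mem_St.1 h
    rwa [ambientExp, transpose_mul, Matrix.mul_assoc, ← Matrix.mul_assoc _ (exp _), mem_St.1 hE,
      Matrix.one_mul] at this
  have e2 : (U + U * S)ᵀ * (U + U * S) = 1 + ((2 : ℝ) • S + S * S) := by
    have h1 := mem_St.1 hU
    rw [transpose_add, transpose_mul, hS, symPart_transpose, ← hS, Matrix.mul_add, Matrix.add_mul,
      Matrix.add_mul, Matrix.mul_assoc S, Matrix.mul_assoc S, ← Matrix.mul_assoc Uᵀ, h1,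
      Matrix.one_mul, Matrix.mul_one]
    module
  rw [e2, add_eq_left, add_eq_zero_iff_eq_neg] at e1
  have h2 := congrArg norm e1
  rw [norm_smul, norm_neg, Real.norm_two] at h2
  have h3 := frobenius_norm_mul S S
  by_contra hne
  have := norm_pos_iff.2 hne
  nlinarith

/-- Allows the inverse function theorem to be applied in the flat matrix space, without charts on
the manifold. -/
theorem hasStrictFDerivAt_ambientExp {U : Matrix (Fin n) (Fin p) ℝ} (hU : U ∈ St n p) :
    HasStrictFDerivAt (ambientExp U)
      (ContinuousLinearEquiv.refl ℝ (Matrix (Fin n) (Fin p) ℝ) : _ →L[ℝ] _) 0 := by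
  obtain ⟨L, hL⟩ : ∃ L : Matrix (Fin n) (Fin p) ℝ →L[ℝ] Matrix (Fin n) (Fin n) ℝ,
      ∀ X, L X = hor U (X - U * symPart U X) := by
    refine ⟨LinearMap.toContinuousLinearMap
      { toFun := fun X => hor U (X - U * symPart U X)
        map_add' := fun X Y => ?_
        map_smul' := fun c X => ?_ }, fun X => rfl⟩
    · rw [← map_add, map_add (symPart U), Matrix.mul_add]; congr 1; abel
    · rw [map_smul, Matrix.mul_smul, ← smul_sub, map_smul]; rfl
  obtain ⟨M, hM⟩ : ∃ M : Matrix (Fin n) (Fin p) ℝ →L[ℝ] Matrix (Fin n) (Fin p) ℝ,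
      ∀ X, M X = U * symPart U X := by
    refine ⟨LinearMap.toContinuousLinearMap
      { toFun := fun X => U * symPart U X
        map_add' := fun X Y => by rw [map_add, Matrix.mul_add]
        map_smul' := fun c X => by rw [map_smul, Matrix.mul_smul]; rfl }, fun X => rfl⟩
  let B : Matrix (Fin n) (Fin n) ℝ →L[ℝ] Matrix (Fin n) (Fin p) ℝ →L[ℝ] Matrix (Fin n) (Fin p) ℝ :=
    (LinearMap.mk₂ ℝ (fun (A : Matrix (Fin n) (Fin n) ℝ) (C : Matrix (Fin n) (Fin p) ℝ) => A * C)
      (fun _ _ _ => Matrix.add_mul _ _ _) (fun _ _ _ => Matrix.smul_mul _ _ _)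
      (fun _ _ _ => Matrix.mul_add _ _ _)
        (fun _ _ _ => Matrix.mul_smul _ _ _)).toContinuousBilinearMap
  have hB : ∀ A C, B A C = A * C := fun A C => rfl
  have h1 : HasStrictFDerivAt (fun X => exp (L X)) L 0 := by
    have h0 : HasStrictFDerivAt (exp : Matrix (Fin n) (Fin n) ℝ → _) (1 : _ →L[ℝ] _) (L 0) := by
      rw [map_zero]; exact hasStrictFDerivAt_exp_zero
    exact h0.comp (0 : Matrix (Fin n) (Fin p) ℝ) L.hasStrictFDerivAt
  have h2 : HasStrictFDerivAt (fun X => U + M X) M 0 := M.hasStrictFDerivAt.const_add U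
  have h3 := B.hasStrictFDerivAt_of_bilinear h1 h2
  have hfun : (fun X => B (exp (L X)) (U + M X)) = ambientExp U := by
    funext X
    rw [hB, hL, hM]; rfl
  rw [← hfun]
  refine HasStrictFDerivAt.congr_fderiv h3 ?_
  ext1 X
  change exp (L 0) * M X + L X * (U + M 0) = X
  rw [map_zero, map_zero, exp_zero, add_zero, Matrix.one_mul, hL, hM,
    hor_mul_self hU (sub_symPart_mem_tangent hU X), add_sub_cancel]

/-- The exponential map is injective near zero. -/
theorem exists_injOn_exp_hor {U : Matrix (Fin n) (Fin p) ℝ} (hU : U ∈ St n p) :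
    ∃ δ > 0, ∀ X ∈ tangent U, ∀ Y ∈ tangent U, ‖X‖ < δ → ‖Y‖ < δ →
      exp (hor U X) * U = exp (hor U Y) * U → X = Y := by
  have h := (hasStrictFDerivAt_ambientExp hU).eventually_left_inverse
  obtain ⟨δ, hδ, hball⟩ := Metric.eventually_nhds_iff.1 h
  refine ⟨δ, hδ, fun X hX Y hY hXδ hYδ he => ?_⟩
  have h1 := hball (y := X) (by simpa using hXδ)
  have h2 := hball (y := Y) (by simpa using hYδ)
  rw [ambientExp_of_mem_tangent hX, he] at h1
  rw [ambientExp_of_mem_tangent hY] at h2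
  exact h1.symm.trans h2

/-- Points of `St(n,p)` near `U` are in the image of the exponential map, which agrees with the
inclusion to first order. -/
theorem eventually_exists_exp_hor {U : Matrix (Fin n) (Fin p) ℝ} (hU : U ∈ St n p) {ε : ℝ}
    (hε : 0 < ε) : ∀ᶠ V in 𝓝 U, V ∈ St n p →
      ∃ X ∈ tangent U, exp (hor U X) * U = V ∧ ‖X - (V - U)‖ ≤ ε * ‖V - U‖ := by
  have hG := hasStrictFDerivAt_ambientExp hU
  have h0 : ambientExp U 0 = U := by simp [ambientExp]
  set g : Matrix (Fin n) (Fin p) ℝ → Matrix (Fin n) (Fin p) ℝ :=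
    hG.localInverse (ambientExp U) _ 0 with hg
  have hg0 : g U = 0 := by
    have : g (ambientExp U 0) = 0 := hG.localInverse_apply_image
    rwa [h0] at this
  have hr := hG.eventually_right_inverse
  have hd := hG.to_localInverse
  rw [h0] at hr hd
  have hlo := hd.hasFDerivAt.isLittleO.def hε
  have hcont : Tendsto (fun V => ‖symPart U (g V)‖) (𝓝 U) (𝓝 0) := by
    have h1 : Tendsto g (𝓝 U) (𝓝 0) := by
      have := hd.hasFDerivAt.continuousAt.tendsto
      rwa [← hg, hg0] at this
    have h2 : Continuous fun X => ‖symPart U X‖ :=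
      (LinearMap.continuous_of_finiteDimensional (symPart U)).norm
    have := (h2.tendsto 0).comp h1
    simpa [Function.comp_def] using this
  filter_upwards [hr, hlo, hcont.eventually (gt_mem_nhds (show (0 : ℝ) < 2 by norm_num))]
    with V h1 h2 h3 hV
  have hX : g V ∈ tangent U := mem_tangent_of_ambientExp_mem_St hU (by rw [h1]; exact hV) h3
  refine ⟨g V, hX, by rw [← ambientExp_of_mem_tangent hX]; exact h1, ?_⟩
  change ‖g V - g U - (V - U)‖ ≤ _ at h2
  rwa [hg0, sub_zero] at h2

theorem eventually_exists_exp_eq {ε : ℝ} (hε : 0 < ε) :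
    ∀ᶠ V in 𝓝 (1 : Matrix (Fin n) (Fin n) ℝ), V ∈ St n n →
      ∃ X : Matrix (Fin n) (Fin n) ℝ, Xᵀ = -X ∧ exp X = V ∧ ‖X - (V - 1)‖ ≤ ε * ‖V - 1‖ := by
  filter_upwards [eventually_exists_exp_hor (one_mem_St (n := n)) hε] with V hV hVS
  obtain ⟨X, hX, he, hn⟩ := hV hVS
  have hXs : Xᵀ = -X := by
    have := mem_tangent.1 hX
    rw [transpose_one, Matrix.one_mul, Matrix.mul_one] at this
    rw [eq_neg_iff_add_eq_zero, add_comm, ← eq_neg_iff_add_eq_zero]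
    exact this
  refine ⟨X, hXs, ?_, hn⟩
  have : hor 1 X = X := by
    rw [hor_apply, hXs]; simp
  rwa [this, Matrix.mul_one] at he

/-! ### Cutting corners, and points reachable by rotations -/

/-- The triangle inequality is strict at a corner. -/
theorem exists_exp_eq_mul_of_ne {A B : Matrix (Fin n) (Fin n) ℝ} (hA : Aᵀ = -A) (hB : Bᵀ = -B)
    (h : ‖B‖ • A ≠ ‖A‖ • B) :
    ∃ C : Matrix (Fin n) (Fin n) ℝ, Cᵀ = -C ∧ exp C = exp A * exp B ∧ ‖C‖ < ‖A‖ + ‖B‖ := by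
  have hlt := norm_add_lt_of_ne h
  set δ := ‖A‖ + ‖B‖ - ‖A + B‖ with hδ
  have hδ0 : 0 < δ := by linarith
  have hAB := norm_nonneg (A + B)
  -- Chosen so that the error of the logarithm of `Q s` is at most `s * (δ / 4)`; the first-order
  -- error of `Q` is another `s * (δ / 4)`, which leaves half of the gain `s * δ`.
  set ε := δ / (4 * (‖A + B‖ + δ)) with hε
  have hε0 : 0 < ε := by positivity
  let Q : ℝ → Matrix (Fin n) (Fin n) ℝ := fun s => exp (s • A) * exp (s • B)
  have hQ0 : Q 0 = 1 := by simp [Q]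
  have hder : HasDerivAt Q (A + B) 0 := by
    have := (hasDerivAt_exp_smul A 0).mul (hasDerivAt_exp_smul B 0)
    refine this.congr_deriv ?_
    simp
  have hev := hder.continuousAt.tendsto
  rw [hQ0] at hev
  have h1 := hev.eventually (eventually_exists_exp_eq hε0)
  have h2 := (hasDerivAt_iff_isLittleO_nhds_zero.1 hder).def (show 0 < δ / 4 by positivity)
  have h3 : ∀ᶠ s : ℝ in 𝓝[>] 0, s < 1 :=
    (eventually_nhdsWithin_of_eventually_nhds (eventually_lt_nhds one_pos))
  obtain ⟨s, ⟨⟨h1, h2⟩, hs1⟩, hs0⟩ :=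
    (((eventually_nhdsWithin_of_eventually_nhds (h1.and h2)).and h3).and self_mem_nhdsWithin).exists
  have hs0 : 0 < s := hs0
  obtain ⟨X, hX, hXe, hXn⟩ := h1
    (mul_mem_St (exp_skew_mem_St (skew_smul hA s)) (exp_skew_mem_St (skew_smul hB s)))
  rw [zero_add, hQ0, Real.norm_of_nonneg hs0.le] at h2
  have hQn : ‖Q s - 1‖ ≤ s * (‖A + B‖ + δ / 4) := by
    have : Q s - 1 = (Q s - 1 - s • (A + B)) + s • (A + B) := by abel
    rw [this]
    refine (norm_add_le _ _).trans ?_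
    rw [norm_smul, Real.norm_of_nonneg hs0.le]
    linarith
  have hXs : ‖X‖ ≤ s * (‖A + B‖ + δ / 2) := by
    have h4 : ‖X‖ ≤ ‖X - (Q s - 1)‖ + ‖Q s - 1‖ := by
      have := norm_add_le (X - (Q s - 1)) (Q s - 1)
      rwa [sub_add_cancel] at this
    have h5 : ε * ‖Q s - 1‖ ≤ s * (δ / 4) := by
      calc ε * ‖Q s - 1‖ ≤ ε * (s * (‖A + B‖ + δ)) := by
            gcongr
            refine hQn.trans ?_
            gcongr
            linarith
        _ = s * (δ / 4) := by rw [hε]; field_simp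
    have h6 : ‖X - (Q s - 1)‖ ≤ ε * ‖Q s - 1‖ := hXn
    nlinarith
  -- The corner piece `exp (s • A) * exp (s • B) = exp X` is replaced by its short logarithm, and
  -- the remaining pieces are attached by the weak triangle inequality.
  obtain ⟨Y, hY, hYe, hYn⟩ := exists_exp_eq_mul (skew_smul hA (1 - s)) hX
  obtain ⟨Z, hZ, hZe, hZn⟩ := exists_exp_eq_mul hY (skew_smul hB (1 - s))
  refine ⟨Z, hZ, ?_, ?_⟩
  · rw [hZe, hYe, hXe]
    calc exp ((1 - s) • A) * (exp (s • A) * exp (s • B)) * exp ((1 - s) • B)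
        = exp ((1 - s) • A) * exp (s • A) * (exp (s • B) * exp ((1 - s) • B)) := by noncomm_ring
      _ = exp A * exp B := by
        rw [← exp_add_smul, ← exp_add_smul, sub_add_cancel, add_sub_cancel, one_smul, one_smul]
  · rw [norm_smul, Real.norm_of_nonneg (sub_nonneg.2 hs1.le)] at hZn hYn
    have : s * (‖A + B‖ + δ / 2) < s * (‖A‖ + ‖B‖) :=
      mul_lt_mul_of_pos_left (by linarith) hs0
    nlinarith

/-- `V` is the image of `U` under the exponential of a skew-symmetric matrix of norm at
most `ℓ`. -/
def Reach (U V : Matrix (Fin n) (Fin p) ℝ) (ℓ : ℝ) : Prop :=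
  ∃ A : Matrix (Fin n) (Fin n) ℝ, Aᵀ = -A ∧ exp A * U = V ∧ ‖A‖ ≤ ℓ

theorem Reach.refl (U : Matrix (Fin n) (Fin p) ℝ) {ℓ : ℝ} (hℓ : 0 ≤ ℓ) : Reach U U ℓ :=
  ⟨0, by simp, by simp, by simpa using hℓ⟩

theorem Reach.trans {U V W : Matrix (Fin n) (Fin p) ℝ} {a b : ℝ} (h₁ : Reach U V a)
    (h₂ : Reach V W b) : Reach U W (a + b) := by
  obtain ⟨A, hA, rfl, hAn⟩ := h₁
  obtain ⟨B, hB, rfl, hBn⟩ := h₂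
  obtain ⟨C, hC, hCe, hCn⟩ := exists_exp_eq_mul hB hA
  exact ⟨C, hC, by rw [hCe, Matrix.mul_assoc], by linarith⟩

theorem Reach.mono {U V : Matrix (Fin n) (Fin p) ℝ} {a b : ℝ} (h : Reach U V a) (hab : a ≤ b) :
    Reach U V b := by
  obtain ⟨A, hA, he, hn⟩ := h
  exact ⟨A, hA, he, hn.trans hab⟩

theorem Reach.symm {U V : Matrix (Fin n) (Fin p) ℝ} {a : ℝ} (h : Reach U V a) : Reach V U a := by
  obtain ⟨A, hA, rfl, hn⟩ := h
  refine ⟨-A, by simp [hA], ?_, by simpa using hn⟩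
  rw [← hA, exp_transpose, ← Matrix.mul_assoc, mem_St.1 (exp_skew_mem_St hA), Matrix.one_mul]

/-- Limits of reachable points are reachable. -/
theorem Reach.of_tendsto {U V : Matrix (Fin n) (Fin p) ℝ} {ℓ : ℝ}
    {v : ℕ → Matrix (Fin n) (Fin p) ℝ} {l : ℕ → ℝ} (h : ∀ k, Reach U (v k) (l k))
    (hv : Tendsto v atTop (𝓝 V)) (hl : Tendsto l atTop (𝓝 ℓ)) : Reach U V ℓ := by
  choose A hA he hn using h
  obtain ⟨M, hM⟩ := hl.bddAbove_range
  have hb : ∀ k, A k ∈ Metric.closedBall (0 : Matrix (Fin n) (Fin n) ℝ) M := fun k => by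
    rw [mem_closedBall_zero_iff]
    exact (hn k).trans (hM ⟨k, rfl⟩)
  obtain ⟨B, -, φ, hφ, hlim⟩ := (isCompact_closedBall _ _).tendsto_subseq hb
  refine ⟨B, ?_, ?_, ?_⟩
  · refine tendsto_nhds_unique (((continuous_id.matrix_transpose).tendsto B).comp hlim) ?_
    exact hlim.neg.congr fun k => (hA (φ k)).symm
  · have hc : Continuous fun X : Matrix (Fin n) (Fin n) ℝ => exp X * U :=
      continuous_exp_matrix.matrix_mul continuous_const
    refine tendsto_nhds_unique ((hc.tendsto B).comp hlim) ?_
    exact (hv.comp hφ.tendsto_atTop).congr fun k => (he (φ k)).symm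
  · exact le_of_tendsto_of_tendsto' hlim.norm (hl.comp hφ.tendsto_atTop) fun k => hn (φ k)

/-- Among the skew-symmetric matrices that carry `U` to `V` there is one of minimal norm. -/
theorem Reach.exists_min {U V : Matrix (Fin n) (Fin p) ℝ} {ℓ : ℝ} (h : Reach U V ℓ) :
    ∃ A : Matrix (Fin n) (Fin n) ℝ, Aᵀ = -A ∧ exp A * U = V ∧ ∀ a, Reach U V a → ‖A‖ ≤ a := by
  have hbdd : BddBelow {a | Reach U V a} := ⟨0, fun a ⟨A, _, _, hn⟩ => (norm_nonneg A).trans hn⟩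
  obtain ⟨l, -, hl, hmem⟩ := exists_seq_tendsto_sInf (S := {a | Reach U V a}) ⟨ℓ, h⟩ hbdd
  obtain ⟨A, hA, he, hn⟩ := Reach.of_tendsto hmem tendsto_const_nhds hl
  exact ⟨A, hA, he, fun a ha => hn.trans (csInf_le hbdd ha)⟩

/-! ### Calculus of matrix-valued curves -/

/-- The entry `(i, j)` of a matrix, as a continuous linear map. -/
noncomputable def entryCLM (i : Fin n) (j : Fin p) : Matrix (Fin n) (Fin p) ℝ →L[ℝ] ℝ :=
  LinearMap.toContinuousLinearMap
    { toFun := fun X => X i j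
      map_add' := fun _ _ => rfl
      map_smul' := fun _ _ => rfl }

theorem hasDerivWithinAt_matrix {c : ℝ → Matrix (Fin n) (Fin p) ℝ}
    {c' : Matrix (Fin n) (Fin p) ℝ} {s : Set ℝ} {t : ℝ} :
    HasDerivWithinAt c c' s t ↔ ∀ i j, HasDerivWithinAt (fun u => c u i j) (c' i j) s t := by
  constructor
  · intro h i j
    exact (entryCLM i j).hasFDerivAt.comp_hasDerivWithinAt t h
  · intro h
    have hsum : ∀ X : Matrix (Fin n) (Fin p) ℝ, X = ∑ i, ∑ j, X i j • single i j (1 : ℝ) := by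
      intro X
      conv_lhs => rw [matrix_eq_sum_single X]
      simp
    have h2 : HasDerivWithinAt (fun u => ∑ i, ∑ j, c u i j • single i j (1 : ℝ))
        (∑ i, ∑ j, c' i j • single i j (1 : ℝ)) s t :=
      HasDerivWithinAt.fun_sum fun i _ => HasDerivWithinAt.fun_sum fun j _ => (h i j).smul_const _
    rw [← hsum c'] at h2
    exact h2.congr (fun u _ => hsum (c u)) (hsum (c t))

theorem hasDerivAt_matrix {c : ℝ → Matrix (Fin n) (Fin p) ℝ}
    {c' : Matrix (Fin n) (Fin p) ℝ} {t : ℝ} :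
    HasDerivAt c c' t ↔ ∀ i j, HasDerivAt (fun u => c u i j) (c' i j) t := by
  refine ⟨fun h i j => ?_, fun h => ?_⟩
  · exact hasDerivWithinAt_univ.1 (hasDerivWithinAt_matrix.1 (hasDerivWithinAt_univ.2 h) i j)
  · exact hasDerivWithinAt_univ.1
      (hasDerivWithinAt_matrix.2 fun i j => hasDerivWithinAt_univ.2 (h i j))

theorem velocity_eq {c : ℝ → Matrix (Fin n) (Fin p) ℝ} {c' : Matrix (Fin n) (Fin p) ℝ} {t : ℝ}
    (h : HasDerivAt c c' t) : velocity c t = c' := by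
  ext i j
  exact (hasDerivAt_matrix.1 h i j).deriv

theorem HasDerivWithinAt.matrixMul {c : ℝ → Matrix (Fin n) (Fin m) ℝ}
    {d : ℝ → Matrix (Fin m) (Fin p) ℝ} {c' : Matrix (Fin n) (Fin m) ℝ}
    {d' : Matrix (Fin m) (Fin p) ℝ} {s : Set ℝ} {t : ℝ} (hc : HasDerivWithinAt c c' s t)
    (hd : HasDerivWithinAt d d' s t) :
    HasDerivWithinAt (fun u => c u * d u) (c' * d t + c t * d') s t := by
  rw [hasDerivWithinAt_matrix] at *
  intro i j
  simp only [Matrix.mul_apply, Matrix.add_apply, ← Finset.sum_add_distrib]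
  exact HasDerivWithinAt.fun_sum fun l _ => (hc i l).mul (hd l j)

theorem HasDerivAt.matrixMul {c : ℝ → Matrix (Fin n) (Fin m) ℝ}
    {d : ℝ → Matrix (Fin m) (Fin p) ℝ} {c' : Matrix (Fin n) (Fin m) ℝ}
    {d' : Matrix (Fin m) (Fin p) ℝ} {t : ℝ} (hc : HasDerivAt c c' t)
    (hd : HasDerivAt d d' t) :
    HasDerivAt (fun u => c u * d u) (c' * d t + c t * d') t :=
  hasDerivWithinAt_univ.1
    (HasDerivWithinAt.matrixMul (hasDerivWithinAt_univ.2 hc) (hasDerivWithinAt_univ.2 hd))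

theorem HasDerivWithinAt.matrixTranspose {c : ℝ → Matrix (Fin n) (Fin m) ℝ}
    {c' : Matrix (Fin n) (Fin m) ℝ} {s : Set ℝ} {t : ℝ} (hc : HasDerivWithinAt c c' s t) :
    HasDerivWithinAt (fun u => (c u)ᵀ) c'ᵀ s t := by
  rw [hasDerivWithinAt_matrix] at *
  exact fun i j => hc j i

theorem HasDerivAt.matrixTranspose {c : ℝ → Matrix (Fin n) (Fin m) ℝ}
    {c' : Matrix (Fin n) (Fin m) ℝ} {t : ℝ} (hc : HasDerivAt c c' t) :
    HasDerivAt (fun u => (c u)ᵀ) c'ᵀ t :=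
  hasDerivWithinAt_univ.1 (HasDerivWithinAt.matrixTranspose (hasDerivWithinAt_univ.2 hc))

theorem HasDerivAt.matrixTrace {c : ℝ → Matrix (Fin n) (Fin n) ℝ}
    {c' : Matrix (Fin n) (Fin n) ℝ} {t : ℝ} (hc : HasDerivAt c c' t) :
    HasDerivAt (fun u => (c u).trace) c'.trace t := by
  rw [hasDerivAt_matrix] at hc
  exact HasDerivAt.fun_sum fun i _ => hc i i

/-! ### Geodesics as orbits of one-parameter groups -/

theorem canonicalMetric_expand (U X Y : Matrix (Fin n) (Fin p) ℝ) :
    canonicalMetric U X Y = (Xᵀ * Y).trace - 1 / 2 * (Xᵀ * U * Uᵀ * Y).trace := by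
  simp only [canonicalMetric, Matrix.mul_sub, Matrix.sub_mul, Matrix.mul_one, Matrix.mul_smul,
    Matrix.smul_mul, trace_sub, trace_smul, smul_eq_mul, Matrix.mul_assoc]

theorem lineDeriv_canonicalMetric (U X Y Z : Matrix (Fin n) (Fin p) ℝ) :
    lineDeriv ℝ (fun V => canonicalMetric V X Y) U Z =
      -(1 / 2) * ((Xᵀ * Z * Uᵀ * Y).trace + (Xᵀ * U * Zᵀ * Y).trace) := by
  have h : HasDerivAt (fun t : ℝ => U + t • Z) Z 0 := by
    have := ((hasDerivAt_id (0 : ℝ)).smul_const Z).const_add U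
    rwa [one_smul] at this
  have hX : HasDerivAt (fun _ : ℝ => Xᵀ) 0 0 := hasDerivAt_const _ _
  have hY : HasDerivAt (fun _ : ℝ => Y) 0 0 := hasDerivAt_const _ _
  have h2 := HasDerivAt.matrixTrace (HasDerivAt.matrixMul (HasDerivAt.matrixMul
    (HasDerivAt.matrixMul hX h) (HasDerivAt.matrixTranspose h)) hY)
  have h3 := (h2.const_mul (1 / 2 : ℝ)).const_sub (Xᵀ * Y).trace
  have h4 := HasDerivAt.deriv (h3.congr_of_eventuallyEq (Eventually.of_forall
    fun t : ℝ => canonicalMetric_expand (U + t • Z) X Y))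
  rw [lineDeriv, h4]
  simp only [zero_smul, add_zero, Matrix.zero_mul, zero_add, Matrix.mul_zero, Matrix.add_mul,
    trace_add]
  ring

/-- Noether's identity: the derivative of the momentum `⟨γ', S γ⟩` along a curve. -/
theorem hasDerivAt_momentum {γ v : ℝ → Matrix (Fin n) (Fin p) ℝ} {a : Matrix (Fin n) (Fin p) ℝ}
    {t : ℝ} (hγ : HasDerivAt γ (v t) t) (hv : HasDerivAt v a t) {S : Matrix (Fin n) (Fin n) ℝ}
    (hS : Sᵀ = -S) :
    HasDerivAt (fun u => canonicalMetric (γ u) (v u) (S * γ u))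
      (canonicalMetric (γ t) a (S * γ t) + christoffel (γ t) (v t) (v t) (S * γ t)) t := by
  have hSγ : HasDerivAt (fun u => S * γ u) (S * v t) t := by
    have := HasDerivAt.matrixMul (hasDerivAt_const t S) hγ
    simpa using this
  have hvT := HasDerivAt.matrixTranspose hv
  have hγT := HasDerivAt.matrixTranspose hγ
  have h1 := HasDerivAt.matrixTrace (HasDerivAt.matrixMul hvT hSγ)
  have h2 := HasDerivAt.matrixTrace (HasDerivAt.matrixMul (HasDerivAt.matrixMul
    (HasDerivAt.matrixMul hvT hγ) hγT) hSγ)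
  have h3 := h1.sub (h2.const_mul (1 / 2 : ℝ))
  refine (h3.congr_of_eventuallyEq
    (Eventually.of_forall fun u => canonicalMetric_expand _ _ _)).congr_deriv ?_
  rw [christoffel, lineDeriv_canonicalMetric, lineDeriv_canonicalMetric, canonicalMetric_expand,
    transpose_mul, hS]
  set U := γ t
  set X := v t
  have e1 : (Xᵀ * (S * X)).trace = 0 := by
    have : (Xᵀ * (S * X)).trace = -(Xᵀ * (S * X)).trace := by
      conv_lhs => rw [← trace_transpose, transpose_mul, transpose_mul, transpose_transpose, hS]
      simp [Matrix.mul_assoc]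
    linarith
  have e2 : (Xᵀ * (S * U) * Uᵀ * X).trace = -(Xᵀ * U * Uᵀ * (S * X)).trace := by
    conv_lhs => rw [← trace_transpose]
    simp [transpose_mul, hS, Matrix.mul_assoc]
  have e3 : (Xᵀ * U * (Uᵀ * -S) * X).trace = -(Xᵀ * U * Uᵀ * (S * X)).trace := by
    simp [Matrix.mul_assoc]
  rw [e2, e3]
  simp only [trace_add, Matrix.add_mul, e1]
  ring

theorem IsGeodesic.hasDerivAt {γ : ℝ → Matrix (Fin n) (Fin p) ℝ} (h : IsGeodesic γ) (t : ℝ) :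
    HasDerivAt γ (velocity γ t) t := by
  rw [hasDerivAt_matrix]
  intro i j
  have := contDiffOn_univ.1 (h.smooth i j)
  exact (this.differentiable (by simp) t).hasDerivAt

theorem IsGeodesic.hasDerivAt_velocity {γ : ℝ → Matrix (Fin n) (Fin p) ℝ} (h : IsGeodesic γ)
    (t : ℝ) : HasDerivAt (velocity γ) (velocity (velocity γ) t) t := by
  rw [hasDerivAt_matrix]
  intro i j
  have := contDiffOn_univ.1 (h.smooth i j)
  have h2 : Differentiable ℝ (deriv fun s => γ s i j) :=
    ((contDiff_infty_iff_deriv.1 this).2.differentiable (by simp))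
  exact (h2 t).hasDerivAt

theorem mem_tangent_of_hasDerivWithinAt {c : ℝ → Matrix (Fin n) (Fin p) ℝ}
    {c' : Matrix (Fin n) (Fin p) ℝ} {s : Set ℝ} {t : ℝ} (h : HasDerivWithinAt c c' s t)
    (hs : UniqueDiffWithinAt ℝ s t) (ht : t ∈ s) (hc : ∀ u ∈ s, c u ∈ St n p) :
    c' ∈ tangent (c t) := by
  have h1 := HasDerivWithinAt.matrixMul (HasDerivWithinAt.matrixTranspose h) h
  have h2 : HasDerivWithinAt (fun u => (c u)ᵀ * c u) 0 s t :=
    (hasDerivWithinAt_const t s (1 : Matrix (Fin p) (Fin p) ℝ)).congr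
      (fun u hu => hc u hu) (hc t ht)
  have h3 := hs.eq_deriv _ h1 h2
  rw [mem_tangent, eq_neg_iff_add_eq_zero, add_comm]
  exact h3

theorem IsGeodesic.velocity_mem_tangent {γ : ℝ → Matrix (Fin n) (Fin p) ℝ} (h : IsGeodesic γ)
    (t : ℝ) : velocity γ t ∈ tangent (γ t) :=
  mem_tangent_of_hasDerivWithinAt (h.hasDerivAt t).hasDerivWithinAt uniqueDiffWithinAt_univ
    (Set.mem_univ t) fun u _ => h.mem u

/-- Geodesics are orbits of one-parameter groups. -/
theorem IsGeodesic.eq_exp {γ : ℝ → Matrix (Fin n) (Fin p) ℝ} (h : IsGeodesic γ) (t : ℝ) :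
    γ t = exp (t • hor (γ 0) (velocity γ 0)) * γ 0 := by
  -- The geodesic equation tested against the Killing field `S * γ` says that the momentum of `S` is
  -- conserved; varying `S` shows that the horizontal lift of the velocity is constant.
  have hconst : ∀ S : Matrix (Fin n) (Fin n) ℝ, Sᵀ = -S → ∀ t,
      ((hor (γ t) (velocity γ t))ᵀ * S).trace = ((hor (γ 0) (velocity γ 0))ᵀ * S).trace := by
    intro S hS t
    rw [trace_hor_transpose_mul _ _ hS, trace_hor_transpose_mul _ _ hS]
    congr 1
    have hd : ∀ u, HasDerivAt (fun u => canonicalMetric (γ u) (velocity γ u) (S * γ u)) 0 u := by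
      intro u
      refine (hasDerivAt_momentum (h.hasDerivAt u) (h.hasDerivAt_velocity u) hS).congr_deriv ?_
      rw [← (h.covDeriv_eq_zero u).2 _ (skew_mul_mem_tangent hS _)]
      simp [canonicalMetric]
    exact is_const_of_deriv_eq_zero (fun u => (hd u).differentiableAt) (fun u => (hd u).deriv) t 0
  have hA : ∀ t, hor (γ t) (velocity γ t) = hor (γ 0) (velocity γ 0) := by
    intro t
    set D := hor (γ t) (velocity γ t) - hor (γ 0) (velocity γ 0) with hD
    have hDs : Dᵀ = -D := by
      rw [hD, transpose_sub, hor_transpose (h.velocity_mem_tangent t),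
        hor_transpose (h.velocity_mem_tangent 0)]
      abel
    have h1 : ‖D‖ ^ 2 = 0 := by
      rw [norm_sq_eq_trace]
      nth_rewrite 1 [hD]
      rw [transpose_sub, Matrix.sub_mul, trace_sub, hconst D hDs t, sub_self]
    exact sub_eq_zero.1 (norm_eq_zero.1 (pow_eq_zero_iff two_ne_zero |>.1 h1))
  set A := hor (γ 0) (velocity γ 0) with hAdef
  have hd : ∀ u, HasDerivAt (fun u : ℝ => exp (u • (-A)) * γ u) 0 u := by
    intro u
    refine (HasDerivAt.matrixMul (hasDerivAt_exp_smul (-A) u) (h.hasDerivAt u)).congr_deriv ?_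
    have : velocity γ u = A * γ u := by
      rw [← hA u, hor_mul_self (h.mem u) (h.velocity_mem_tangent u)]
    rw [this]
    simp [Matrix.mul_assoc]
  have h0 := is_const_of_deriv_eq_zero (fun u => (hd u).differentiableAt)
    (fun u => (hd u).deriv) t 0
  simp only [zero_smul, exp_zero, Matrix.one_mul] at h0
  rw [← h0, ← Matrix.mul_assoc, smul_neg, ← neg_smul, ← exp_add_smul, add_neg_cancel, zero_smul,
    exp_zero, Matrix.one_mul]

/-- Equivariance of `hor` together with the commutation of a matrix with its exponential: the lift
of the velocity is constant along the orbit. -/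
theorem hor_exp_smul {U X : Matrix (Fin n) (Fin p) ℝ} (hU : U ∈ St n p) (hX : X ∈ tangent U)
    (t : ℝ) : hor (exp (t • hor U X) * U) (hor U X * (exp (t • hor U X) * U)) = hor U X := by
  have hE := exp_skew_mem_St (skew_smul (hor_transpose hX) t)
  have hcomm : Commute (hor U X) (exp (t • hor U X)) :=
    ((Commute.refl (hor U X)).smul_right t).exp_right
  rw [← Matrix.mul_assoc, hcomm.eq, Matrix.mul_assoc, hor_mul_self hU hX, hor_mul_left hE,
    ← hcomm.eq, Matrix.mul_assoc, mul_transpose_of_mem_St hE, Matrix.mul_one]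

theorem contDiff_exp_smul_mul (A : Matrix (Fin n) (Fin n) ℝ) (U : Matrix (Fin n) (Fin p) ℝ)
    (i : Fin n) (j : Fin p) : ContDiff ℝ ∞ fun t : ℝ => (exp (t • A) * U) i j := by
  have h1 : ContDiff ℝ ∞ fun t : ℝ => exp (t • A) := by
    have h2 : ContDiff ℝ ∞ (exp : Matrix (Fin n) (Fin n) ℝ → Matrix (Fin n) (Fin n) ℝ) := by
      have : AnalyticOnNhd ℝ (exp : Matrix (Fin n) (Fin n) ℝ → _) Set.univ :=
        fun x _ => exp_analytic (𝕂 := ℝ) x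
      exact contDiffOn_univ.1 (this.contDiffOn uniqueDiffOn_univ)
    exact h2.comp (contDiff_id.smul contDiff_const)
  simp only [Matrix.mul_apply]
  refine ContDiff.sum fun l _ => ContDiff.mul ?_ contDiff_const
  exact (entryCLM i l).contDiff.comp h1

theorem hasDerivAt_exp_smul_mul (A : Matrix (Fin n) (Fin n) ℝ) (U : Matrix (Fin n) (Fin p) ℝ)
    (t : ℝ) : HasDerivAt (fun u : ℝ => exp (u • A) * U) (A * (exp (t • A) * U)) t := by
  have := HasDerivAt.matrixMul (hasDerivAt_exp_smul' A t) (hasDerivAt_const t U)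
  simpa [Matrix.mul_assoc] using this

theorem isGeodesic_exp {U X : Matrix (Fin n) (Fin p) ℝ} (hU : U ∈ St n p) (hX : X ∈ tangent U) :
    IsGeodesic fun t : ℝ => exp (t • hor U X) * U := by
  set A := hor U X with hA
  set γ : ℝ → Matrix (Fin n) (Fin p) ℝ := fun t => exp (t • A) * U with hγ
  have hmem : ∀ t, γ t ∈ St n p := fun t =>
    mul_mem_St (exp_skew_mem_St (skew_smul (hor_transpose hX) t)) hU
  have hd : ∀ t, HasDerivAt γ (A * γ t) t := fun t => hasDerivAt_exp_smul_mul A U t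
  have hv : velocity γ = fun t => A * γ t := funext fun t => velocity_eq (hd t)
  have hd2 : ∀ t, HasDerivAt (velocity γ) (A * (A * γ t)) t := by
    intro t
    rw [hv]
    simpa using HasDerivAt.matrixMul (hasDerivAt_const t A) (hd t)
  refine ⟨fun i j => (contDiff_exp_smul_mul A U i j).contDiffOn, hmem, fun t => ⟨?_, ?_⟩⟩
  · rw [mem_tangent]; simp
  · intro W hW
    have hS := hor_transpose hW
    have h1 := hasDerivAt_momentum (v := velocity γ) (by rw [hv]; exact hd t) (hd2 t) hS
    -- Converse use of Noether's identity: `W` extends to the Killing field of its lift, whose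
    -- momentum is constant on the orbit, so the derivative in `h1` is zero.
    have h2 : (fun u => canonicalMetric (γ u) (velocity γ u) (hor (γ t) W * γ u)) =
        fun _ => (Aᵀ * hor (γ t) W).trace / 2 := by
      funext u
      have h3 := trace_hor_transpose_mul (γ u) (velocity γ u) hS
      rw [hv, hor_exp_smul hU hX u] at h3
      rw [hv]
      linarith
    rw [h2] at h1
    have h4 := h1.unique (hasDerivAt_const t _)
    rw [hor_mul_self (hmem t) hW] at h4
    rw [velocity_eq (hd2 t), h4]
    simp [canonicalMetric]

theorem velocity_exp_smul_mul (A : Matrix (Fin n) (Fin n) ℝ) (U : Matrix (Fin n) (Fin p) ℝ)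
    (t : ℝ) : velocity (fun u : ℝ => exp (u • A) * U) t = A * (exp (t • A) * U) :=
  velocity_eq (hasDerivAt_exp_smul_mul A U t)

/-- The Riemannian exponential of `St(n,p)`. -/
theorem riemExp_eq {U X : Matrix (Fin n) (Fin p) ℝ} (hU : U ∈ St n p) (hX : X ∈ tangent U) :
    riemExp U X = exp (hor U X) * U := by
  have hex : ∃ V, ∃ γ : ℝ → Matrix (Fin n) (Fin p) ℝ,
      IsGeodesic γ ∧ γ 0 = U ∧ velocity γ 0 = X ∧ γ 1 = V := by
    refine ⟨_, _, isGeodesic_exp hU hX, ?_, ?_, rfl⟩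
    · simp
    · rw [velocity_exp_smul_mul]
      simp [hor_mul_self hU hX]
  obtain ⟨γ, hγ, h0, hv, h1⟩ := Classical.epsilon_spec hex
  rw [riemExp, ← h1, hγ.eq_exp 1, h0, hv, one_smul]

/-! ### Curve length, distance and norms of rotations -/

theorem tangentNorm_orbit {U : Matrix (Fin n) (Fin p) ℝ} (hU : U ∈ St n p)
    {A : Matrix (Fin n) (Fin n) ℝ} (hA : Aᵀ = -A) (t : ℝ) :
    tangentNorm (exp (t • A) * U) (velocity (fun u : ℝ => exp (u • A) * U) t) =
      ‖hor U (A * U)‖ / √2 := by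
  have hE := exp_skew_mem_St (skew_smul hA t)
  rw [velocity_exp_smul_mul, tangentNorm_eq (mul_mem_St hE hU) (skew_mul_mem_tangent hA _)]
  have hcomm : Commute A (exp (t • A)) := ((Commute.refl A).smul_right t).exp_right
  rw [← Matrix.mul_assoc, hcomm.eq, Matrix.mul_assoc, hor_mul_left hE,
    norm_mul_right_of_mem_St (transpose_mem_St hE), norm_mul_left_of_mem_St hE]

theorem riemDist_exp_le {U : Matrix (Fin n) (Fin p) ℝ} (hU : U ∈ St n p)
    {A : Matrix (Fin n) (Fin n) ℝ} (hA : Aᵀ = -A) :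
    riemDist U (exp A * U) ≤ ENNReal.ofReal (‖hor U (A * U)‖ / √2) := by
  refine sInf_le ⟨fun t : ℝ => exp (t • A) * U, 0, 1, ⟨1, fun i => i, by simp, by simp, ?_⟩, ?_,
    by simp, by simp, ?_⟩
  · intro i _
    exact ⟨by simp, fun i j => (contDiff_exp_smul_mul A U i j).contDiffOn⟩
  · exact fun t _ => mul_mem_St (exp_skew_mem_St (skew_smul hA t)) hU
  · rw [curveLength]
    simp only [tangentNorm_orbit hU hA]
    simp

theorem continuous_hor : Continuous fun q : Matrix (Fin n) (Fin p) ℝ × Matrix (Fin n) (Fin p) ℝ =>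
    hor q.1 q.2 := by
  simp only [hor_apply]
  fun_prop

theorem exists_norm_hor_le (U : Matrix (Fin n) (Fin p) ℝ) :
    ∃ K : ℝ, 0 ≤ K ∧ ∀ X, ‖hor U X‖ ≤ K * ‖X‖ := by
  obtain ⟨K, hK, h⟩ := (LinearMap.toContinuousLinearMap (hor U)).bound
  exact ⟨K, hK.le, h⟩

theorem exists_small {K M ε : ℝ} (hK : 0 ≤ K) (hM : 0 ≤ M) (hε : 0 < ε) :
    ∃ η : ℝ, 0 < η ∧ η ≤ 1 ∧ K * (η * (M + 2)) ≤ ε := by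
  refine ⟨min 1 (ε / (K * (M + 2) + 1)), lt_min one_pos (by positivity), min_le_left _ _, ?_⟩
  have h1 : min 1 (ε / (K * (M + 2) + 1)) ≤ ε / (K * (M + 2) + 1) := min_le_right _ _
  have h2 : 0 ≤ K * (M + 2) := by positivity
  calc K * (min 1 (ε / (K * (M + 2) + 1)) * (M + 2))
      = K * (M + 2) * min 1 (ε / (K * (M + 2) + 1)) := by ring
    _ ≤ K * (M + 2) * (ε / (K * (M + 2) + 1)) := by gcongr
    _ ≤ ε := by
      rw [← mul_div_assoc, div_le_iff₀ (by positivity)]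
      nlinarith

/-- To first order, a curve in `St(n,p)` can be followed by rotations of norm at most its speed. -/
theorem eventually_reach {c : ℝ → Matrix (Fin n) (Fin p) ℝ} {w : Matrix (Fin n) (Fin p) ℝ}
    {x : ℝ} (hx : c x ∈ St n p) (hc : ∀ᶠ y in 𝓝[>] x, c y ∈ St n p)
    (hd : HasDerivWithinAt c w (Set.Ioi x) x) {ε : ℝ} (hε : 0 < ε) :
    ∀ᶠ y in 𝓝[>] x, Reach (c x) (c y) ((y - x) * (‖hor (c x) w‖ + ε)) := by
  obtain ⟨K, hK0, hK⟩ := exists_norm_hor_le (c x)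
  -- The factor `‖w‖ + 2` collects both errors: at most `η (‖w‖ + 1)` per unit time from the
  -- logarithm and `η` from the derivative of `c`.
  obtain ⟨η, hη0, hη1, hη⟩ := exists_small hK0 (norm_nonneg w) hε
  have h1 := hd.continuousWithinAt.tendsto.eventually (eventually_exists_exp_hor hx hη0)
  have h2 := (hasDerivWithinAt_iff_isLittleO.1 hd).def hη0
  filter_upwards [hc, h1, h2, self_mem_nhdsWithin] with y hyS h1 h2 hyx
  have hyx : 0 < y - x := sub_pos.2 hyx
  rw [Real.norm_of_nonneg hyx.le] at h2
  obtain ⟨X, hX, hXe, hXn⟩ := h1 hyS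
  refine ⟨hor (c x) X, hor_transpose hX, hXe, ?_⟩
  have h3 : ‖c y - c x‖ ≤ (y - x) * (‖w‖ + η) := by
    have : c y - c x = (c y - c x - (y - x) • w) + (y - x) • w := by abel
    rw [this]
    refine (norm_add_le _ _).trans ?_
    rw [norm_smul, Real.norm_of_nonneg hyx.le]
    linarith
  have h4 : ‖X - (y - x) • w‖ ≤ (y - x) * (η * (‖w‖ + 2)) := by
    have : X - (y - x) • w = (X - (c y - c x)) + (c y - c x - (y - x) • w) := by abel
    rw [this]
    refine (norm_add_le _ _).trans ?_
    have h5 : η * ‖c y - c x‖ ≤ η * ((y - x) * (‖w‖ + 1)) := by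
      gcongr
      refine h3.trans ?_
      gcongr
    nlinarith
  have h6 : hor (c x) X = hor (c x) (X - (y - x) • w) + (y - x) • hor (c x) w := by
    rw [← map_smul, ← map_add, sub_add_cancel]
  rw [h6]
  refine (norm_add_le _ _).trans ?_
  rw [norm_smul, Real.norm_of_nonneg hyx.le]
  have h7 : ‖hor (c x) (X - (y - x) • w)‖ ≤ (y - x) * ε := by
    refine (hK _).trans ?_
    calc K * ‖X - (y - x) • w‖ ≤ K * ((y - x) * (η * (‖w‖ + 2))) := by gcongr
      _ = (y - x) * (K * (η * (‖w‖ + 2))) := by ring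
      _ ≤ (y - x) * ε := by gcongr
  linarith

theorem reach_of_hasDerivWithinAt {c w : ℝ → Matrix (Fin n) (Fin p) ℝ} {a b : ℝ} (hab : a ≤ b)
    (hc : ∀ t ∈ Set.Icc a b, c t ∈ St n p)
    (hd : ∀ t ∈ Set.Icc a b, HasDerivWithinAt c (w t) (Set.Icc a b) t) {f : ℝ → ℝ}
    (hf : Continuous f) (hfw : ∀ t ∈ Set.Icc a b, f t = ‖hor (c t) (w t)‖) :
    Reach (c a) (c b) (∫ t in a..b, f t) := by
  set F : ℝ → ℝ := fun t => ∫ u in a..t, f u with hF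
  have hFd : ∀ t, HasDerivAt F (f t) t := fun t => hf.integral_hasStrictDerivAt a t |>.hasDerivAt
  have hFc : Continuous F := continuous_iff_continuousAt.2 fun t => (hFd t).continuousAt
  have hcc : ContinuousOn c (Set.Icc a b) := fun t ht => (hd t ht).continuousWithinAt
  -- Continuous induction on the interval with slack `ε` per unit time: half pays for
  -- `eventually_reach`, half for the differentiation of `F`. Compactness gives closedness and
  -- removes the slack at the end.
  have key : ∀ ε > 0, Reach (c a) (c b) (F b + ε * (b - a)) := by
    intro ε hε
    have hsub : Set.Icc a b ⊆ {t | Reach (c a) (c t) (F t + ε * (t - a))} := by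
      refine IsClosed.Icc_subset_of_forall_mem_nhdsWithin ?_ ?_ ?_
      · refine isSeqClosed_iff_isClosed.1 fun u t hu ht => ?_
        have htI : t ∈ Set.Icc a b := isClosed_Icc.mem_of_tendsto ht
          (Eventually.of_forall fun k => (hu k).2)
        refine ⟨Reach.of_tendsto (fun k => (hu k).1) ?_ ?_, htI⟩
        · exact (hcc t htI).tendsto.comp
            (tendsto_nhdsWithin_iff.2 ⟨ht, Eventually.of_forall fun k => (hu k).2⟩)
        · have : Continuous fun t => F t + ε * (t - a) := by fun_prop
          exact (this.tendsto t).comp ht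
      · show Reach (c a) (c a) (F a + ε * (a - a))
        simp only [hF, intervalIntegral.integral_same, sub_self, mul_zero, add_zero]
        exact Reach.refl _ le_rfl
      · rintro x ⟨hxS, hxI⟩
        have hxI' : x ∈ Set.Icc a b := ⟨hxI.1, hxI.2.le⟩
        have hnear : ∀ᶠ y in 𝓝[>] x, y ∈ Set.Icc a b := by
          filter_upwards [Ioc_mem_nhdsGT hxI.2] with y hy
          exact ⟨hxI.1.trans hy.1.le, hy.2⟩
        have hd' : HasDerivWithinAt c (w x) (Set.Ioi x) x := by
          refine (hd x hxI').mono_of_mem_nhdsWithin ?_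
          exact hnear
        have h1 := eventually_reach (hc x hxI') (hnear.mono fun y hy => hc y hy) hd'
          (half_pos hε)
        have h2 := ((hasDerivAt_iff_isLittleO.1 (hFd x)).def (half_pos hε)).filter_mono
          (nhdsWithin_le_nhds (s := Set.Ioi x))
        filter_upwards [h1, h2, self_mem_nhdsWithin] with y h1 h2 hyx
        have hyx : 0 < y - x := sub_pos.2 hyx
        refine (Reach.trans hxS h1).mono ?_
        rw [Real.norm_of_nonneg hyx.le, smul_eq_mul, hfw x hxI'] at h2
        have := (abs_le.1 h2).1
        nlinarith
    exact hsub ⟨hab, le_rfl⟩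
  refine Reach.of_tendsto (v := fun _ => c b) (fun k : ℕ => key (1 / ((k : ℝ) + 1)) (by positivity))
    tendsto_const_nhds ?_
  have := (tendsto_one_div_add_atTop_nhds_zero_nat (𝕜 := ℝ)).mul_const (b - a) |>.const_add (F b)
  simpa using this

theorem exists_reach_of_smoothOn {c : ℝ → Matrix (Fin n) (Fin p) ℝ} {a b : ℝ} (hab : a < b)
    (hc : ∀ t ∈ Set.Icc a b, c t ∈ St n p) (hs : SmoothOn c (Set.Icc a b)) :
    ∃ ℓ : ℝ, 0 ≤ ℓ ∧ Reach (c a) (c b) ℓ ∧ ENNReal.ofReal (ℓ / √2) ≤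
      ∫⁻ t in Set.Ioo a b, ENNReal.ofReal (tangentNorm (c t) (velocity c t)) := by
  -- One-sided derivatives, continuous up to the ends of the piece; `velocity c` is only known to
  -- agree with them in the interior, hence the open interval in the integral.
  set w : ℝ → Matrix (Fin n) (Fin p) ℝ :=
    fun t => Matrix.of fun i j => derivWithin (fun s => c s i j) (Set.Icc a b) t with hw
  have hU := uniqueDiffOn_Icc hab
  have hd : ∀ t ∈ Set.Icc a b, HasDerivWithinAt c (w t) (Set.Icc a b) t := by
    intro t ht
    rw [hasDerivWithinAt_matrix]
    intro i j
    exact ((hs i j).differentiableOn (by simp) t ht).hasDerivWithinAt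
  have hcc : ContinuousOn c (Set.Icc a b) := fun t ht => (hd t ht).continuousWithinAt
  have hwc : ContinuousOn w (Set.Icc a b) := by
    refine continuousOn_pi.2 fun i => continuousOn_pi.2 fun j => ?_
    exact (hs i j).continuousOn_derivWithin hU (by simp)
  have hg : ContinuousOn (fun t => ‖hor (c t) (w t)‖) (Set.Icc a b) := by
    refine ContinuousOn.norm ?_
    exact continuous_hor.comp_continuousOn (f := fun t => (c t, w t)) (hcc.prodMk hwc)
  set f : ℝ → ℝ :=
    Set.IccExtend hab.le ((Set.Icc a b).domRestrict fun t => ‖hor (c t) (w t)‖) with hf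
  have hfc : Continuous f := hg.domRestrict.Icc_extend'
  have hfw : ∀ t ∈ Set.Icc a b, f t = ‖hor (c t) (w t)‖ := fun t ht =>
    Set.IccExtend_of_mem hab.le _ ht
  have hf0 : ∀ t, 0 ≤ f t := fun t => norm_nonneg _
  refine ⟨_, ?_, reach_of_hasDerivWithinAt hab.le hc hd hfc hfw, ?_⟩
  · exact intervalIntegral.integral_nonneg hab.le fun t _ => hf0 t
  · rw [← intervalIntegral.integral_div, intervalIntegral.integral_of_le hab.le,
      integral_Ioc_eq_integral_Ioo, ofReal_integral_eq_lintegral_ofReal]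
    · refine le_of_eq (setLIntegral_congr_fun measurableSet_Ioo fun t ht => ?_)
      have htI := Set.Ioo_subset_Icc_self ht
      have hv : velocity c t = w t := velocity_eq ((hd t htI).hasDerivAt (Icc_mem_nhds ht.1 ht.2))
      have hwt := mem_tangent_of_hasDerivWithinAt (hd t htI) (hU t htI) htI hc
      rw [hv, tangentNorm_eq (hc t htI) hwt, hfw t htI]
    · exact ((hfc.div_const _).integrableOn_Icc (a := a) (b := b)).mono_set Set.Ioo_subset_Icc_self
    · exact Eventually.of_forall fun t => div_nonneg (hf0 t) (Real.sqrt_nonneg _)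

/-- A piecewise smooth curve in `St(n,p)` is not shorter than some orbit of a one-parameter
group. -/
theorem exists_reach_le_curveLength {c : ℝ → Matrix (Fin n) (Fin p) ℝ} {a b : ℝ}
    (hs : PiecewiseSmooth c a b) (hc : ∀ t ∈ Set.Icc a b, c t ∈ St n p) :
    ∃ ℓ : ℝ, 0 ≤ ℓ ∧ Reach (c a) (c b) ℓ ∧ ENNReal.ofReal (ℓ / √2) ≤ curveLength c a b := by
  obtain ⟨k, τ, h0, hk, hτ⟩ := hs
  have hmono : ∀ i ≤ k, ∀ j ≤ i, τ j ≤ τ i := by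
    intro i
    induction i with
    | zero => intro _ j hj; rw [Nat.le_zero.1 hj]
    | succ i ih =>
      intro hi j hj
      rcases Nat.lt_or_ge i j with h | h
      · rw [le_antisymm hj h]
      · exact (ih (by omega) j h).trans (hτ i (by omega)).1.le
  have key : ∀ i ≤ k, ∃ ℓ : ℝ, 0 ≤ ℓ ∧ Reach (c a) (c (τ i)) ℓ ∧
      ENNReal.ofReal (ℓ / √2) ≤ curveLength c a (τ i) := by
    intro i
    induction i with
    | zero => intro _; exact ⟨0, le_rfl, by rw [h0]; exact Reach.refl _ le_rfl, by simp⟩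
    | succ i ih =>
      intro hi
      obtain ⟨ℓ, hℓ, hr, hl⟩ := ih (by omega)
      obtain ⟨hlt, hsm⟩ := hτ i (by omega)
      have ha : a ≤ τ i := h0 ▸ hmono i (by omega) 0 (by omega)
      have hb : τ (i + 1) ≤ b := hk ▸ hmono k le_rfl (i + 1) hi
      obtain ⟨ℓ', hℓ', hr', hl'⟩ := exists_reach_of_smoothOn hlt
        (fun t ht => hc t ⟨ha.trans ht.1, ht.2.trans hb⟩) hsm
      refine ⟨ℓ + ℓ', add_nonneg hℓ hℓ', hr.trans hr', ?_⟩
      rw [add_div, ENNReal.ofReal_add (by positivity) (by positivity)]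
      refine (add_le_add hl hl').trans ?_
      rw [curveLength, curveLength, ← lintegral_union measurableSet_Ioo]
      · refine lintegral_mono_set ?_
        rintro t (ht | ht)
        · exact ⟨ht.1, ht.2.trans hlt.le⟩
        · exact ⟨ha.trans ht.1.le, ht.2.le⟩
      · rw [Set.disjoint_left]
        intro t ht ht'
        exact absurd ht.2 (not_le.2 ht'.1)
  have := key k le_rfl
  rwa [hk] at this

/-- The distance of two points in a component of `St(n,p)` is attained by a geodesic. -/
theorem Reach.exists_horizontal {U V : Matrix (Fin n) (Fin p) ℝ} (hU : U ∈ St n p) {ℓ : ℝ}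
    (h : Reach U V ℓ) : ∃ A : Matrix (Fin n) (Fin n) ℝ, Aᵀ = -A ∧ exp A * U = V ∧
      A = hor U (A * U) ∧ (∀ a, Reach U V a → ‖A‖ ≤ a) ∧
      riemDist U V = ENNReal.ofReal (‖A‖ / √2) := by
  obtain ⟨A, hA, he, hmin⟩ := h.exists_min
  have hle : riemDist U V ≤ ENNReal.ofReal (‖hor U (A * U)‖ / √2) := by
    rw [← he]; exact riemDist_exp_le hU hA
  have hge : ENNReal.ofReal (‖A‖ / √2) ≤ riemDist U V := by
    refine le_sInf ?_
    rintro L ⟨c, a, b, hs, hc, rfl, rfl, rfl⟩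
    obtain ⟨l, hl, hr, hlen⟩ := exists_reach_le_curveLength hs hc
    refine le_trans ?_ hlen
    have := hmin l hr
    gcongr
  have h2 : (0 : ℝ) < √2 := by positivity
  -- The orbit of `A` has length `‖hor U (A * U)‖ / √2`, and no curve is shorter than `‖A‖ / √2`; so
  -- `A` has no part killing `U`.
  have hnorm : ‖A‖ ≤ ‖hor U (A * U)‖ := by
    have := (ENNReal.ofReal_le_ofReal_iff (by positivity)).1 (hge.trans hle)
    rwa [div_le_div_iff_of_pos_right h2] at this
  refine ⟨A, hA, he, eq_hor_of_norm_le hU hA hnorm, hmin, le_antisymm (hle.trans ?_) hge⟩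
  have := norm_hor_le hU hA
  gcongr

theorem exists_gt_ofReal_lt {a : ℝ} {r : ℝ≥0∞} (h : ENNReal.ofReal a < r) :
    ∃ b, a < b ∧ ENNReal.ofReal b < r := by
  obtain ⟨q, hq, hqr⟩ := exists_between h
  have hqt : q ≠ ⊤ := hqr.ne_top
  rw [← ENNReal.ofReal_toReal hqt] at hq hqr
  exact ⟨q.toReal, (ENNReal.ofReal_lt_ofReal_iff'.1 hq).1, hqr⟩

/-! ### Homogeneity under the orthogonal group -/

/-- The points of `St(n,p)` are the first `p` columns of orthogonal matrices. -/
theorem exists_orthogonal_completion (hpn : p ≤ n) {U : Matrix (Fin n) (Fin p) ℝ}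
    (hU : U ∈ St n p) : ∃ B ∈ St n n, B.submatrix id (Fin.castLE hpn) = U := by
  let v : Fin n → EuclideanSpace ℝ (Fin n) := fun i =>
    if h : (i : ℕ) < p then WithLp.toLp 2 (fun l => U l ⟨i, h⟩) else 0
  have hv : Orthonormal ℝ (({i : Fin n | (i : ℕ) < p} : Set (Fin n)).domRestrict v) := by
    rw [orthonormal_iff_ite]
    rintro ⟨i, hi⟩ ⟨j, hj⟩
    have hi' : (i : ℕ) < p := hi
    have hj' : (j : ℕ) < p := hj
    have h := congrFun (congrFun (mem_St.1 hU) ⟨i, hi'⟩) ⟨j, hj'⟩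
    simp only [Matrix.mul_apply, transpose_apply, Matrix.one_apply] at h
    simp only [Set.domRestrict_apply, v, hi', hj', dif_pos, PiLp.inner_apply, Subtype.mk.injEq]
    simp only [Fin.mk.injEq, Fin.val_inj] at h
    rw [← h]
    exact Finset.sum_congr rfl fun l _ => by simp [mul_comm]
  obtain ⟨b, hb⟩ := hv.exists_orthonormalBasis_extension_of_card_eq (by simp)
  refine ⟨Matrix.of fun l i => b i l, ?_, ?_⟩
  · rw [mem_St]
    ext i j
    have h := orthonormal_iff_ite.1 b.orthonormal i j
    simp only [Matrix.mul_apply, transpose_apply, Matrix.one_apply, of_apply]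
    rw [← h, PiLp.inner_apply]
    exact Finset.sum_congr rfl fun l _ => by simp [mul_comm]
  · ext l j
    have := hb (Fin.castLE hpn j) (by simp)
    simp [this, v]

/-- The orthogonal group acts transitively on `St(n,p)`. -/
theorem exists_orthogonal_mul_eq (hpn : p ≤ n) {U V : Matrix (Fin n) (Fin p) ℝ} (hU : U ∈ St n p)
    (hV : V ∈ St n p) : ∃ Q ∈ St n n, Q * U = V := by
  obtain ⟨B, hB, rfl⟩ := exists_orthogonal_completion hpn hU
  obtain ⟨C, hC, rfl⟩ := exists_orthogonal_completion hpn hV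
  refine ⟨C * Bᵀ, mul_mem_St hC (transpose_mem_St hB), ?_⟩
  have h : ∀ D : Matrix (Fin n) (Fin n) ℝ, D.submatrix id (Fin.castLE hpn) =
      D * (1 : Matrix (Fin n) (Fin n) ℝ).submatrix id (Fin.castLE hpn) := by
    intro D
    ext i j
    simp [Matrix.mul_apply, Matrix.one_apply]
  rw [h B, h C, Matrix.mul_assoc, ← Matrix.mul_assoc Bᵀ, mem_St.1 hB, Matrix.one_mul]

theorem exp_conj_of_mem_St {Q : Matrix (Fin n) (Fin n) ℝ} (hQ : Q ∈ St n n)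
    (A : Matrix (Fin n) (Fin n) ℝ) : exp (Q * A * Qᵀ) = Q * exp A * Qᵀ := by
  have hinv : Q⁻¹ = Qᵀ := Matrix.inv_eq_left_inv (mem_St.1 hQ)
  have hunit : IsUnit Q := IsUnit.of_mul_eq_one _ (mul_transpose_of_mem_St hQ)
  rw [← hinv, Matrix.exp_conj Q A hunit]

theorem riemExp_mul {Q : Matrix (Fin n) (Fin n) ℝ} (hQ : Q ∈ St n n)
    {U X : Matrix (Fin n) (Fin p) ℝ} (hU : U ∈ St n p) (hX : X ∈ tangent U) :
    riemExp (Q * U) (Q * X) = Q * riemExp U X := by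
  rw [riemExp_eq hU hX, riemExp_eq (mul_mem_St hQ hU) (mul_mem_tangent hQ hX), hor_mul_left hQ,
    exp_conj_of_mem_St hQ, Matrix.mul_assoc _ Qᵀ, ← Matrix.mul_assoc Qᵀ, mem_St.1 hQ,
    Matrix.one_mul, Matrix.mul_assoc]

theorem mul_mem_tangentBall {Q : Matrix (Fin n) (Fin n) ℝ} (hQ : Q ∈ St n n)
    {U X : Matrix (Fin n) (Fin p) ℝ} (hU : U ∈ St n p) {r : ℝ≥0∞} (hX : X ∈ tangentBall U r) :
    Q * X ∈ tangentBall (Q * U) r := by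
  refine ⟨mul_mem_tangent hQ hX.1, ?_⟩
  rw [tangentNorm_eq (mul_mem_St hQ hU) (mul_mem_tangent hQ hX.1), hor_mul_left hQ,
    norm_mul_right_of_mem_St (transpose_mem_St hQ), norm_mul_left_of_mem_St hQ,
    ← tangentNorm_eq hU hX.1]
  exact hX.2

theorem injRadiusAt_le_mul {Q : Matrix (Fin n) (Fin n) ℝ} (hQ : Q ∈ St n n)
    {U : Matrix (Fin n) (Fin p) ℝ} (hU : U ∈ St n p) :
    injRadiusAt U ≤ injRadiusAt (Q * U) := by
  refine sSup_le_sSup fun r hr X hX Y hY hXY => ?_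
  have hQU := mul_mem_St hQ hU
  have hQT := transpose_mem_St hQ
  have hback : Qᵀ * (Q * U) = U := by rw [← Matrix.mul_assoc, mem_St.1 hQ, Matrix.one_mul]
  have hX' := mul_mem_tangentBall hQT hQU hX
  have hY' := mul_mem_tangentBall hQT hQU hY
  have h1 := riemExp_mul hQT hQU hX.1
  have h2 := riemExp_mul hQT hQU hY.1
  rw [hback] at hX' hY' h1 h2
  have h3 := hr hX' hY' (by rw [h1, h2, hXY])
  have := congrArg (fun Z => Q * Z) h3
  simpa only [← Matrix.mul_assoc, mul_transpose_of_mem_St hQ, Matrix.one_mul] using this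

/-- The injectivity radius does not depend on the point. -/
theorem injRadiusAt_eq (hpn : p ≤ n) {U V : Matrix (Fin n) (Fin p) ℝ} (hU : U ∈ St n p)
    (hV : V ∈ St n p) : injRadiusAt U = injRadiusAt V := by
  have hle : ∀ {U V : Matrix (Fin n) (Fin p) ℝ}, U ∈ St n p → V ∈ St n p →
      injRadiusAt U ≤ injRadiusAt V := by
    intro U V hU hV
    obtain ⟨Q, hQ, rfl⟩ := exists_orthogonal_mul_eq hpn hU hV
    exact injRadiusAt_le_mul hQ hU
  exact le_antisymm (hle hU hV) (hle hV hU)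

/-! ### Minimising geodesics, the cut locus and injectivity -/

theorem reach_exp (U : Matrix (Fin n) (Fin p) ℝ) {A : Matrix (Fin n) (Fin n) ℝ} (hA : Aᵀ = -A) :
    Reach U (exp A * U) ‖A‖ := ⟨A, hA, rfl, le_rfl⟩

theorem reach_exp_smul (U : Matrix (Fin n) (Fin p) ℝ) {A : Matrix (Fin n) (Fin n) ℝ}
    (hA : Aᵀ = -A) {s t : ℝ} (hst : s ≤ t) :
    Reach (exp (s • A) * U) (exp (t • A) * U) ((t - s) * ‖A‖) := by
  refine ⟨(t - s) • A, skew_smul hA _, ?_, ?_⟩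
  · rw [← Matrix.mul_assoc, ← exp_add_smul, sub_add_cancel]
  · rw [norm_smul, Real.norm_of_nonneg (sub_nonneg.2 hst)]

theorem tangentNorm_smul {U X : Matrix (Fin n) (Fin p) ℝ} (hU : U ∈ St n p) (hX : X ∈ tangent U)
    {t : ℝ} (ht : 0 ≤ t) : tangentNorm U (t • X) = t * tangentNorm U X := by
  rw [tangentNorm_eq hU hX, tangentNorm_eq hU (smul_mem_tangent hX t), map_smul, norm_smul,
    Real.norm_of_nonneg ht, mul_div_assoc]

/-- A geodesic realises the distance exactly when no rotation along it can be shortened. -/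
theorem riemDist_exp_eq_iff {U : Matrix (Fin n) (Fin p) ℝ} (hU : U ∈ St n p)
    {A : Matrix (Fin n) (Fin n) ℝ} (hA : Aᵀ = -A) :
    riemDist U (exp A * U) = ENNReal.ofReal (‖A‖ / √2) ↔
      ∀ a, Reach U (exp A * U) a → ‖A‖ ≤ a := by
  have h2 : (0 : ℝ) < √2 := by positivity
  obtain ⟨C, hC, he, -, hmin, hd⟩ := (reach_exp U hA).exists_horizontal hU
  rw [hd, ENNReal.ofReal_eq_ofReal_iff (by positivity) (by positivity), div_left_inj' h2.ne']
  constructor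
  · rintro h a ha
    rw [← h]; exact hmin a ha
  · intro h
    exact le_antisymm (hmin _ (reach_exp U hA)) (h _ (he ▸ reach_exp U hC))

/-- Geodesics are locally minimising. -/
theorem exists_pos_minimising {U X : Matrix (Fin n) (Fin p) ℝ} (hU : U ∈ St n p)
    (hX : X ∈ tangent U) :
    ∃ t : ℝ, 0 < t ∧ ∀ a, Reach U (exp (t • hor U X) * U) a → ‖t • hor U X‖ ≤ a := by
  obtain ⟨δ, hδ, hinj⟩ := exists_injOn_exp_hor hU
  obtain ⟨t, ht, h1, h2⟩ : ∃ t : ℝ, 0 < t ∧ t * ‖X‖ < δ ∧ t * (‖hor U X‖ * ‖U‖) < δ := by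
    have hc : ∀ M : ℝ, ∀ᶠ t : ℝ in 𝓝[>] 0, t * M < δ := by
      intro M
      have : Tendsto (fun t : ℝ => t * M) (𝓝 0) (𝓝 0) := by
        simpa using (tendsto_id (α := ℝ) (x := 𝓝 0)).mul_const M
      exact eventually_nhdsWithin_of_eventually_nhds (this.eventually (gt_mem_nhds hδ))
    obtain ⟨t, ⟨h1, h2⟩, h3⟩ := (((hc ‖X‖).and (hc (‖hor U X‖ * ‖U‖))).and
      self_mem_nhdsWithin).exists
    exact ⟨t, h3, h1, h2⟩
  refine ⟨t, ht, ?_⟩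
  have hA := hor_transpose (smul_mem_tangent hX t)
  rw [map_smul] at hA
  obtain ⟨C, hC, he, hCh, hmin, -⟩ := (reach_exp U hA).exists_horizontal hU
  have hle := hmin _ (reach_exp U hA)
  -- The minimal `C` is no longer than `t • hor U X`, so both initial vectors lie in the ball where
  -- the exponential is injective.
  have hCX : C * U = t • X := by
    refine hinj _ (skew_mul_mem_tangent hC U) _ (smul_mem_tangent hX t) ?_ ?_ ?_
    · refine (frobenius_norm_mul _ _).trans_lt (lt_of_le_of_lt ?_ h2)
      rw [norm_smul, Real.norm_of_nonneg ht.le] at hle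
      rw [← mul_assoc]
      gcongr
    · rwa [norm_smul, Real.norm_of_nonneg ht.le]
    · rw [← hCh, he, map_smul]
  rw [hCh, hCX, map_smul] at hmin
  exact hmin

theorem isCutPointAlong_exp {U X : Matrix (Fin n) (Fin p) ℝ} (hU : U ∈ St n p)
    (hX : X ∈ tangent U) (h1 : tangentNorm U X = 1) {t₀ : ℝ} (ht₀ : 0 < t₀)
    (hset : {t : ℝ | 0 < t ∧ riemDist U (exp (t • hor U X) * U) = ENNReal.ofReal t} =
      Set.Ioc 0 t₀) :
    exp (t₀ • hor U X) * U ∈ cutLocus U := by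
  refine ⟨_, isGeodesic_exp hU hX, fun t => ?_, by simp, t₀, ht₀, ?_, rfl⟩
  · rw [tangentNorm_orbit hU (hor_transpose hX), hor_mul_self hU hX, ← tangentNorm_eq hU hX, h1]
  · simpa using hset

/-- Unit speed geodesics are minimising up to the distance of the cut locus. -/
theorem minimising_of_lt_distToSet_of_unit {U X : Matrix (Fin n) (Fin p) ℝ} (hU : U ∈ St n p)
    (hX : X ∈ tangent U) (h1 : tangentNorm U X = 1) {t : ℝ} (ht : 0 < t)
    (hlt : ENNReal.ofReal t < distToSet U (cutLocus U)) :
    ∀ a, Reach U (exp (t • hor U X) * U) a → ‖t • hor U X‖ ≤ a := by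
  by_contra hnot
  have hA := hor_transpose hX
  set A := hor U X with hAdef
  have hsq : (0 : ℝ) < √2 := by positivity
  have hnA : ‖A‖ = √2 := by
    rw [tangentNorm_eq hU hX, div_eq_one_iff_eq hsq.ne'] at h1
    exact h1
  have hApos : 0 < ‖A‖ := hnA ▸ hsq
  set T : Set ℝ := {t | 0 < t ∧ riemDist U (exp (t • A) * U) = ENNReal.ofReal t} with hT
  have hmemT : ∀ s, s ∈ T ↔ 0 < s ∧ ∀ a, Reach U (exp (s • A) * U) a → s * ‖A‖ ≤ a := by
    intro s
    refine and_congr_right fun hs => ?_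
    have h := riemDist_exp_eq_iff hU (skew_smul hA s)
    rw [norm_smul, Real.norm_of_nonneg hs.le] at h
    rw [← h, hnA, mul_div_cancel_right₀ _ hsq.ne']
  -- A shortcut to an earlier point, followed by the rest of the geodesic, would be a shortcut to
  -- the later one.
  have hdown : ∀ s ∈ T, ∀ u, 0 < u → u ≤ s → u ∈ T := by
    intro s hs u hu hus
    rw [hmemT] at hs ⊢
    refine ⟨hu, fun a ha => ?_⟩
    have := hs.2 _ (ha.trans (reach_exp_smul U hA hus))
    linarith
  have htT : t ∉ T := by
    intro h
    refine hnot ?_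
    rw [norm_smul, Real.norm_of_nonneg ht.le]
    exact ((hmemT t).1 h).2
  have hbdd : ∀ s ∈ T, s ≤ t := by
    intro s hs
    by_contra hc
    exact htT (hdown s hs t ht (not_le.1 hc).le)
  obtain ⟨s₀, hs₀, hs₀min⟩ := exists_pos_minimising hU hX
  have hs₀T : s₀ ∈ T := by
    rw [hmemT]
    rw [norm_smul, Real.norm_of_nonneg hs₀.le] at hs₀min
    exact ⟨hs₀, hs₀min⟩
  have hBA : BddAbove T := ⟨t, hbdd⟩
  set t₀ := sSup T with ht₀def
  have ht₀ : 0 < t₀ := hs₀.trans_le (le_csSup hBA hs₀T)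
  have ht₀T : t₀ ∈ T := by
    rw [hmemT]
    refine ⟨ht₀, fun a ha => ?_⟩
    refine le_of_forall_pos_le_add fun ε hε => ?_
    -- The gap `t₀ - s` is paid twice, in going back from time `t₀` to `s` and in comparing `s *
    -- ‖A‖` with `t₀ * ‖A‖`; hence the 2.
    obtain ⟨s, hsT, hs⟩ := exists_lt_of_lt_csSup ⟨s₀, hs₀T⟩
      (show t₀ - ε / (2 * ‖A‖) < sSup T from sub_lt_self _ (by positivity))
    have hst : s ≤ t₀ := le_csSup hBA hsT
    have h3 := ((hmemT s).1 hsT).2 _ (ha.trans (reach_exp_smul U hA hst).symm)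
    have h4 : (t₀ - s) * (2 * ‖A‖) ≤ ε := by
      rw [← le_div_iff₀ (by positivity)]; linarith
    nlinarith
  have hset : T = Set.Ioc 0 t₀ := by
    ext s
    exact ⟨fun hs => ⟨hs.1, le_csSup hBA hs⟩, fun hs => hdown t₀ ht₀T s hs.1 hs.2⟩
  have hcut := isCutPointAlong_exp hU hX h1 ht₀ hset
  have hle : distToSet U (cutLocus U) ≤ ENNReal.ofReal t₀ := by
    refine (iInf₂_le _ hcut).trans ?_
    rw [← hAdef, ht₀T.2]
  exact absurd hlt (not_lt.2 (hle.trans (ENNReal.ofReal_le_ofReal (hbdd t₀ ht₀T))))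

theorem minimising_of_lt_distToSet {U X : Matrix (Fin n) (Fin p) ℝ} (hU : U ∈ St n p)
    (hX : X ∈ tangent U)
    (hlt : ENNReal.ofReal (tangentNorm U X) < distToSet U (cutLocus U)) :
    ∀ a, Reach U (exp (hor U X) * U) a → ‖hor U X‖ ≤ a := by
  have hsq : (0 : ℝ) < √2 := by positivity
  rcases (norm_nonneg (hor U X)).eq_or_lt with h0 | hpos
  · rintro a ⟨A, -, -, hn⟩
    rw [← h0]
    exact (norm_nonneg A).trans hn
  · have htpos : 0 < tangentNorm U X := by
      rw [tangentNorm_eq hU hX]; positivity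
    set t := tangentNorm U X
    have hY := smul_mem_tangent hX t⁻¹
    have hY1 : tangentNorm U (t⁻¹ • X) = 1 := by
      rw [tangentNorm_smul hU hX (inv_nonneg.2 htpos.le)]
      exact inv_mul_cancel₀ htpos.ne'
    have := minimising_of_lt_distToSet_of_unit hU hY hY1 htpos hlt
    rwa [← map_smul, smul_smul, mul_inv_cancel₀ htpos.ne', one_smul] at this

/-- The exponential map is injective inside the cut locus. -/
theorem injOn_riemExp {U : Matrix (Fin n) (Fin p) ℝ} (hU : U ∈ St n p) :
    Set.InjOn (riemExp U) (tangentBall U (distToSet U (cutLocus U))) := by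
  intro X hX Y hY hXY
  have hsq : (0 : ℝ) < √2 := by positivity
  rw [riemExp_eq hU hX.1, riemExp_eq hU hY.1] at hXY
  have hA := hor_transpose hX.1
  have hB := hor_transpose hY.1
  have hXm := minimising_of_lt_distToSet hU hX.1 hX.2
  have hYm := minimising_of_lt_distToSet hU hY.1 hY.2
  have hnorm : ‖hor U X‖ = ‖hor U Y‖ := by
    refine le_antisymm (hXm _ ?_) (hYm _ ?_)
    · rw [hXY]; exact reach_exp U hB
    · rw [← hXY]; exact reach_exp U hA
  suffices h : hor U X = hor U Y by
    rw [← hor_mul_self hU hX.1, h, hor_mul_self hU hY.1]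
  rcases (norm_nonneg (hor U X)).eq_or_lt with h0 | hpos
  · rw [norm_eq_zero.1 h0.symm, norm_eq_zero.1 (h0.trans hnorm).symm]
  by_contra hne
  have hXpos : 0 < tangentNorm U X := by
    rw [tangentNorm_eq hU hX.1]; positivity
  -- The ball is open, so the geodesic of `X` can be prolonged by a factor `t > 1` and still
  -- minimise.
  obtain ⟨b, hb, hbr⟩ := exists_gt_ofReal_lt hX.2
  set t := b / tangentNorm U X with ht
  have ht1 : 1 < t := (one_lt_div hXpos).2 hb
  have htm := minimising_of_lt_distToSet hU (smul_mem_tangent hX.1 t) (by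
    rw [tangentNorm_smul hU hX.1 (by linarith), ht, div_mul_cancel₀ _ hXpos.ne']
    exact hbr)
  rw [map_smul, norm_smul, Real.norm_of_nonneg (by linarith)] at htm
  have ht0 : 0 < t - 1 := sub_pos.2 ht1
  -- Follow `Y` to the common endpoint and continue along `X`: equal norms and different directions
  -- make a genuine corner there.
  obtain ⟨C, hC, hCe, hCn⟩ := exists_exp_eq_mul_of_ne (skew_smul hA (t - 1)) hB (by
    rw [norm_smul, Real.norm_of_nonneg ht0.le, ← hnorm, smul_smul, mul_comm]
    exact fun h => hne (smul_right_injective _ (mul_pos ht0 hpos).ne' h))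
  have hr : Reach U (exp (t • hor U X) * U) ‖C‖ := by
    refine ⟨C, hC, ?_, le_rfl⟩
    rw [hCe, Matrix.mul_assoc, ← hXY, ← Matrix.mul_assoc]
    nth_rewrite 2 [← one_smul ℝ (hor U X)]
    rw [← exp_add_smul, sub_add_cancel]
  have h3 := htm _ hr
  rw [norm_smul, Real.norm_of_nonneg ht0.le, ← hnorm] at hCn
  linarith

/-- The exponential map is not injective beyond the cut locus. -/
theorem le_distToSet_of_injOn {U : Matrix (Fin n) (Fin p) ℝ} (hU : U ∈ St n p) {r : ℝ≥0∞}
    (hinj : Set.InjOn (riemExp U) (tangentBall U r)) : r ≤ distToSet U (cutLocus U) := by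
  refine le_iInf₂ ?_
  rintro V ⟨γ, hγ, hunit, h0, t₀, ht₀, hset, rfl⟩
  have hsq : (0 : ℝ) < √2 := by positivity
  have ht₀mem : t₀ ∈ {t : ℝ | 0 < t ∧ riemDist (γ 0) (γ t) = ENNReal.ofReal t} := by
    rw [hset]; exact ⟨ht₀, le_rfl⟩
  have hX := hγ.velocity_mem_tangent 0
  have hX1 := hunit 0
  have heq := hγ.eq_exp
  rw [h0] at hX hX1 ht₀mem hset heq
  rw [ht₀mem.2]
  by_contra hlt
  -- A time after the cut point but still inside the ball of injectivity.
  obtain ⟨t, htt, htr⟩ := exists_gt_ofReal_lt (not_le.1 hlt)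
  have ht : 0 < t := ht₀.trans htt
  set X := velocity γ 0
  have htX := smul_mem_tangent hX t
  have htn : tangentNorm U (t • X) = t := by rw [tangentNorm_smul hU hX ht.le, hX1, mul_one]
  have hA := hor_transpose htX
  obtain ⟨C, hC, he, hCh, hmin, hd⟩ := (reach_exp U hA).exists_horizontal hU
  have hCt := skew_mul_mem_tangent hC U
  have hCn : tangentNorm U (C * U) = ‖C‖ / √2 := by rw [tangentNorm_eq hU hCt, ← hCh]
  have hle : tangentNorm U (C * U) ≤ t := by
    have h := hmin _ (reach_exp U hA)
    rw [hCn, ← htn, tangentNorm_eq hU htX]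
    gcongr
  have hCX : C * U = t • X := by
    refine hinj ⟨hCt, (ENNReal.ofReal_le_ofReal hle).trans_lt htr⟩ ⟨htX, by rwa [htn]⟩ ?_
    rw [riemExp_eq hU hCt, riemExp_eq hU htX, ← hCh, he]
  have hmem : t ∈ {t : ℝ | 0 < t ∧ riemDist U (γ t) = ENNReal.ofReal t} := by
    refine ⟨ht, ?_⟩
    rw [heq t, ← map_smul, hd, ← hCn, hCX, htn]
  rw [hset] at hmem
  exact absurd hmem.2 (not_le.2 htt)

/-- At each point, the injectivity radius is the distance of the cut locus. -/
theorem injRadiusAt_eq_distToSet {U : Matrix (Fin n) (Fin p) ℝ} (hU : U ∈ St n p) :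
    injRadiusAt U = distToSet U (cutLocus U) :=
  le_antisymm (sSup_le fun _ hr => le_distToSet_of_injOn hU hr) (le_sSup (injOn_riemExp hU))

end StiefelManifold

theorem mainTheorem2 (n p : ℕ) (hpn : p ≤ n) :
    (∀ U ∈ StiefelManifold.St n p, ∀ V ∈ StiefelManifold.St n p,
      StiefelManifold.distToSet U (StiefelManifold.cutLocus U) =
        StiefelManifold.distToSet V (StiefelManifold.cutLocus V)) ∧
    (∀ U ∈ StiefelManifold.St n p,
      StiefelManifold.injRadius n p =
        StiefelManifold.distToSet U (StiefelManifold.cutLocus U)) := by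
  refine ⟨fun U hU V hV => ?_, fun U hU => ?_⟩
  · rw [← StiefelManifold.injRadiusAt_eq_distToSet hU,
      ← StiefelManifold.injRadiusAt_eq_distToSet hV]
    exact StiefelManifold.injRadiusAt_eq hpn hU hV
  · rw [← StiefelManifold.injRadiusAt_eq_distToSet hU]
    exact le_antisymm (iInf₂_le U hU)
      (le_iInf₂ fun V hV => (StiefelManifold.injRadiusAt_eq hpn hU hV).le)
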